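/- Let $\omega$ be a non-principal ultrafilter on $\mathbb N$, let $(X_i,d_i,e_i)_{i\in\mathbb N}$ be pointed metric spaces with their Borel $\sigma$-algebras, and let $p\in[1,\infty)$. Notation. For a metric space $Y$, $\mathcal P_p(Y)$ is the set of Radon probability measures on $Y$ with finite $p$-th moment, with the distance $W_p(\mu,\nu)=\inf_\gamma\big(\int d(x,y)^p\,d\gamma(x,y)\big)^{1/p}$, the infimum being over all couplings $\gamma$ of $\mu$ and $\nu$. Write $[(y_i)]$ for the class of a sequence in the ultraproduct along $\omega$, and $st$ for the standard part of a nearstandard hyperreal. The metric ultralimit of pointed spaces $(Y_i,\rho_i,o_i)$ is the limited part $Y^\omega_{\lim}=\{y^\omega: \rho^\omega(y^\omega,o^\omega)\text{ is nearstandard}\}$ of the ultraproduct, modulo $\rho^\omega(y^\omega,z^\omega)\approx 0$, with the distance $st\,\rho^\omega$. Let $(\hat X,\hat d)$ be the metric ultralimit of $(X_i,d_i,e_i)$, with quotient map $st_{\hat d}:X^\omega_{\lim}\to\hat X$, and let $(\widehat{\mathcal P_p(X)},\hat W_p)$ be the metric ultralimit of $(\mathcal P_p(X_i),W_p,\delta_{e_i})$,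 with quotient map $st_{\hat W_p}:\mathcal P_p(X)^\omega_{\lim}\to\widehat{\mathcal P_p(X)}$. Let $\iota:\mathcal P_p(\hat X)\to\widehat{\mathcal P_p(X)}$ be the canonical isometric embedding, i.e. the extension by density of $$\frac1N\sum_{j=1}^N\delta_{st_{\hat d}[(x_{j,i})_i]}\longmapsto st_{\hat W_p}\Big[\Big(\frac1N\sum_{j=1}^N\delta_{x_{j,i}}\Big)_i\Big].$$ An element $\mu^\omega\in\mathcal P_p(X)^\omega_{\lim}$ is a $\hat W_p$-lifting of $\mu\in\mathcal P_p(\hat X)$ if $\iota\mu=st_{\hat W_p}(\mu^\omega)$. The Loeb measure $\mu_L$ of $\mu^\omega=[(\mu_i)]$ is the Carathéodory extension, to the $\sigma$-algebra of Carathéodory measurable subsets of $X^\omega$, of the premeasure $[(B_i)]\mapsto st[(\mu_i(B_i))]$ on ultraproducts of Borel sets. Its pushforward $\mu_L\circ st_{\hat d}^{-1}$ is well-defined if $st_{\hat d}^{-1}(B)$ is $\mu_L$-measurable for every Borel set $B\subseteq\hat X$. Lemma. Let $\mu^\omega\in\mathcal P_p(X)^\omega_{\lim}$, and suppose that $\mu^\omega(X^\omega\setminus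 B(e^\omega,D))=0$ for some $D\in\mathbb R$, where $B(e^\omega,D)=\{x^\omega : d^\omega(x^\omega,e^\omega)<D\}$. If the pushforward $\mu_L\circ st_{\hat d}^{-1}$ is well-defined and belongs to $\mathcal P_p(\hat X)$, then $\mu^\omega$ is a $\hat W_p$-lifting of $\mu_L\circ st_{\hat d}^{-1}$. -/

import Mathlib

open Filter Topology MeasureTheory
open scoped ENNReal

noncomputable section

namespace WassersteinUltralimit

universe u

/-! ## Hyperreals and ultraproducts -/

/-- The hyperreals: the ultrapower of `ℝ` along `ω`. -/
abbrev Hyper (ω : Ultrafilter ℕ) : Type := Germ (ω : Filter ℕ) ℝ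

/-- `r` is infinitesimally close to some real `a`; for `r = [(r i)]`, `r.Tendsto (𝓝 a)` says that
`|r i - a| < ε` holds `ω`-almost surely for every real `ε > 0`. -/
def Nearstandard {ω : Ultrafilter ℕ} (r : Hyper ω) : Prop := ∃ a : ℝ, r.Tendsto (𝓝 a)

open Classical in
/-- The standard part of a nearstandard hyperreal (with value `0` on all other hyperreals). -/
def st {ω : Ultrafilter ℕ} (r : Hyper ω) : ℝ := if h : Nearstandard r then h.choose else 0

/-- The ultraproduct of a sequence of types. -/
abbrev UProd (ω : Ultrafilter ℕ) (Y : ℕ → Type u) : Type u := (ω : Filter ℕ).Product Y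

/-- The class `[(y i)]` of a sequence. -/
def UProd.mk (ω : Ultrafilter ℕ) {Y : ℕ → Type u} (y : ∀ i, Y i) : UProd ω Y :=
  Quotient.mk (productSetoid (ω : Filter ℕ) Y) y

/-- The ultraproduct of a sequence of real functions of two variables. -/
def UProd.map₂ {ω : Ultrafilter ℕ} {Y Z : ℕ → Type*} (f : ∀ i, Y i → Z i → ℝ) :
    UProd ω Y → UProd ω Z → Hyper ω :=
  Quotient.map₂ (fun y z i => f i (y i) (z i)) fun _ _ hy _ _ hz => by
    filter_upwards [hy, hz] with i h₁ h₂
    rw [h₁, h₂]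

/-- The hyperreal-valued distance `[(y i)], [(z i)] ↦ [(dist (y i) (z i))]`. -/
def hyperDist {ω : Ultrafilter ℕ} {Y : ℕ → Type u} [∀ i, Dist (Y i)] (y z : UProd ω Y) : Hyper ω :=
  UProd.map₂ (fun _ a b => dist a b) y z

/-! ## Metric ultralimits -/

/-- The limited part of the ultraproduct: the points at finite distance from `[(e i)]`. -/
def LimitedPart (ω : Ultrafilter ℕ) {Y : ℕ → Type u} [∀ i, Dist (Y i)] (e : ∀ i, Y i) : Type u :=
  {y : UProd ω Y // Nearstandard (hyperDist y (UProd.mk ω e))}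

/-- The metric ultralimit as a type: the limited part modulo `d^ω(y, z) ≈ 0`. -/
def Ultralimit (ω : Ultrafilter ℕ) {Y : ℕ → Type u} [∀ i, Dist (Y i)] (e : ∀ i, Y i) : Type u :=
  Quot fun y z : LimitedPart ω e => (hyperDist y.1 z.1).Tendsto (𝓝 0)

/-- The quotient map from the limited part to the ultralimit. -/
def pushdown {ω : Ultrafilter ℕ} {Y : ℕ → Type u} [∀ i, Dist (Y i)] {e : ∀ i, Y i}
    (y : LimitedPart ω e) : Ultralimit ω e :=
  Quot.mk _ y

theorem st_eq_of_tendsto {ω : Ultrafilter ℕ} {r : Hyper ω} {a : ℝ} (h : r.Tendsto (𝓝 a)) :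
    st r = a := by
  have hr : Nearstandard r := ⟨a, h⟩
  rw [st, dif_pos hr]
  have h' := hr.choose_spec
  generalize hr.choose = b at h' ⊢
  induction r using Germ.inductionOn with
  | h f => exact tendsto_nhds_unique (Germ.coe_tendsto.1 h') (Germ.coe_tendsto.1 h)

theorem tendsto_st {ω : Ultrafilter ℕ} {r : Hyper ω} (h : Nearstandard r) :
    r.Tendsto (𝓝 (st r)) := by
  obtain ⟨a, ha⟩ := h
  rwa [st_eq_of_tendsto ha]

theorem exists_tendsto_of_bounded (ω : Ultrafilter ℕ) (f : ℕ → ℝ) (C : ℝ)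
    (h0 : ∀ᶠ i in (ω : Filter ℕ), f i ∈ Set.Icc 0 C) :
    ∃ a, Tendsto f (ω : Filter ℕ) (𝓝 a) := by
  obtain ⟨a, -, ha⟩ := (isCompact_Icc (a := (0 : ℝ)) (b := C)).ultrafilter_le_nhds (ω.map f)
    (by rw [le_principal_iff]; exact h0)
  exact ⟨a, ha⟩

section Metric

variable {ω : Ultrafilter ℕ} {Y : ℕ → Type u} [∀ i, PseudoMetricSpace (Y i)] {e : ∀ i, Y i}

theorem nearstandard_hyperDist (y z : LimitedPart ω e) : Nearstandard (hyperDist y.1 z.1) := by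
  obtain ⟨⟨y⟩, a, ha⟩ := y
  obtain ⟨⟨z⟩, b, hb⟩ := z
  have ha' : Tendsto (fun i => dist (y i) (e i)) (ω : Filter ℕ) (𝓝 a) := ha
  have hb' : Tendsto (fun i => dist (z i) (e i)) (ω : Filter ℕ) (𝓝 b) := hb
  refine exists_tendsto_of_bounded ω (fun i => dist (y i) (z i)) (a + b + 1) ?_
  filter_upwards [(ha'.add hb').eventually (gt_mem_nhds (lt_add_one (a + b)))] with i hi
  exact ⟨dist_nonneg, (dist_triangle_right _ _ (e i)).trans hi.le⟩

theorem tendsto_hyperDist (y z : LimitedPart ω e) :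
    (hyperDist y.1 z.1).Tendsto (𝓝 (st (hyperDist y.1 z.1))) :=
  tendsto_st (nearstandard_hyperDist y z)

theorem st_hyperDist_self (y : LimitedPart ω e) : st (hyperDist y.1 y.1) = 0 := by
  obtain ⟨⟨y⟩, hy⟩ := y
  refine st_eq_of_tendsto (show Tendsto (fun i => dist (y i) (y i)) (ω : Filter ℕ) (𝓝 0) from ?_)
  simp

theorem st_hyperDist_comm (y z : LimitedPart ω e) :
    st (hyperDist y.1 z.1) = st (hyperDist z.1 y.1) := by
  have h : hyperDist y.1 z.1 = hyperDist z.1 y.1 := by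
    obtain ⟨⟨y⟩, hy⟩ := y
    obtain ⟨⟨z⟩, hz⟩ := z
    exact congrArg (fun f : ℕ → ℝ => (f : Hyper ω)) (funext fun i => dist_comm (y i) (z i))
  rw [h]

theorem st_hyperDist_triangle (x y z : LimitedPart ω e) :
    st (hyperDist x.1 z.1) ≤ st (hyperDist x.1 y.1) + st (hyperDist y.1 z.1) := by
  have h₁ := tendsto_hyperDist x z
  have h₂ := tendsto_hyperDist x y
  have h₃ := tendsto_hyperDist y z
  generalize st (hyperDist x.1 z.1) = a at *
  generalize st (hyperDist x.1 y.1) = b at *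
  generalize st (hyperDist y.1 z.1) = c at *
  obtain ⟨⟨x⟩, hx⟩ := x
  obtain ⟨⟨y⟩, hy⟩ := y
  obtain ⟨⟨z⟩, hz⟩ := z
  have h₁' : Tendsto (fun i => dist (x i) (z i)) (ω : Filter ℕ) (𝓝 a) := h₁
  have h₂' : Tendsto (fun i => dist (x i) (y i)) (ω : Filter ℕ) (𝓝 b) := h₂
  have h₃' : Tendsto (fun i => dist (y i) (z i)) (ω : Filter ℕ) (𝓝 c) := h₃
  exact le_of_tendsto_of_tendsto' h₁' (h₂'.add h₃') fun i => dist_triangle _ _ _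

theorem st_hyperDist_congr {x y z : LimitedPart ω e} (h : (hyperDist y.1 z.1).Tendsto (𝓝 0)) :
    st (hyperDist x.1 y.1) = st (hyperDist x.1 z.1) := by
  have h₀ : st (hyperDist y.1 z.1) = 0 := st_eq_of_tendsto h
  have h₁ := st_hyperDist_triangle x y z
  have h₂ := st_hyperDist_triangle x z y
  rw [st_hyperDist_comm z y] at h₂
  linarith

/-- The metric of the ultralimit: `d̂(pushdown y, pushdown z) = st (d^ω(y, z))`. -/
instance : MetricSpace (Ultralimit ω e) where
  dist := Quot.lift₂ (fun y z => st (hyperDist y.1 z.1)) (fun _ _ _ h => st_hyperDist_congr h)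
    fun y₁ y₂ z h => by
      rw [st_hyperDist_comm y₁ z, st_hyperDist_comm y₂ z]
      exact st_hyperDist_congr h
  dist_self := by rintro ⟨y⟩; exact st_hyperDist_self y
  dist_comm := by rintro ⟨y⟩ ⟨z⟩; exact st_hyperDist_comm y z
  dist_triangle := by rintro ⟨x⟩ ⟨y⟩ ⟨z⟩; exact st_hyperDist_triangle x y z
  eq_of_dist_eq_zero := by
    rintro ⟨y⟩ ⟨z⟩ h
    have h' : st (hyperDist y.1 z.1) = 0 := h
    exact Quot.sound (h' ▸ tendsto_hyperDist y z)

/-- The ultralimit carries its Borel `σ`-algebra. -/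
instance : MeasurableSpace (Ultralimit ω e) := borel _

instance : BorelSpace (Ultralimit ω e) := ⟨rfl⟩

end Metric

/-! ## Wasserstein spaces -/

/-- `𝒫_p(X)`: the Radon probability measures on `X` with finite `p`-th moment. (For a finite Borel
measure, being Radon means inner regularity with respect to compact sets.) -/
def PSpace (p : ℝ) (X : Type u) [MetricSpace X] [MeasurableSpace X] : Type u :=
  {μ : Measure X // IsProbabilityMeasure μ ∧ μ.InnerRegular ∧
    ∃ x₀ : X, ∫⁻ x, edist x x₀ ^ p ∂μ < ∞}

/-- The couplings of `μ` and `ν`. (Radon measures live on `σ`-compact sets, so a coupling of two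
of them on the product `σ`-algebra is the restriction of a unique Radon measure on `X × X`, and
the distance is almost everywhere measurable for it.) -/
def couplings {X : Type u} [MeasurableSpace X] (μ ν : Measure X) : Set (Measure (X × X)) :=
  {γ | γ.map Prod.fst = μ ∧ γ.map Prod.snd = ν}

/-- The `p`-Wasserstein distance `W_p`. -/
def wDist (p : ℝ) {X : Type u} [MetricSpace X] [MeasurableSpace X] (μ ν : Measure X) : ℝ :=
  ((⨅ γ ∈ couplings μ ν, ∫⁻ z, edist z.1 z.2 ^ p ∂γ) ^ (1 / p)).toReal

instance (p : ℝ) (X : Type u) [MetricSpace X] [MeasurableSpace X] : Dist (PSpace p X) :=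
  ⟨fun μ ν => wDist p μ.1 ν.1⟩

/-- The uniformly weighted point cloud `(1/N) ∑ⱼ δ_{x j}` as a measure. -/
def cloudMeasure {X : Type u} [MeasurableSpace X] {N : ℕ} (x : Fin N → X) : Measure X :=
  (N : ℝ≥0∞)⁻¹ • ∑ j, Measure.dirac (x j)

theorem cloudMeasure_mem {p : ℝ} {X : Type u} [MetricSpace X] [MeasurableSpace X]
    [BorelSpace X] (hp : 1 ≤ p) {N : ℕ} (hN : 0 < N) (x : Fin N → X) :
    IsProbabilityMeasure (cloudMeasure x) ∧ (cloudMeasure x).InnerRegular ∧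
      ∃ x₀ : X, ∫⁻ y, edist y x₀ ^ p ∂(cloudMeasure x) < ∞ := by
  have hN' : (N : ℝ≥0∞) ≠ 0 := by exact_mod_cast hN.ne'
  refine ⟨⟨?_⟩, ⟨fun U hU r hr => ?_⟩, x ⟨0, hN⟩, ?_⟩
  · simp [cloudMeasure, ENNReal.inv_mul_cancel hN' (ENNReal.natCast_ne_top N)]
  · have hfin : (Set.range x ∩ U).Finite := (Set.finite_range x).subset Set.inter_subset_left
    refine ⟨Set.range x ∩ U, Set.inter_subset_right, hfin.isCompact, ?_⟩
    have h : cloudMeasure x (Set.range x ∩ U) = cloudMeasure x U := by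
      simp only [cloudMeasure, Measure.smul_apply, Measure.finsetSum_apply]
      congr 1
      refine Finset.sum_congr rfl fun j _ => ?_
      rw [Measure.dirac_apply' _ hfin.measurableSet, Measure.dirac_apply' _ hU]
      by_cases hj : x j ∈ U <;> simp [Set.indicator, hj]
    rwa [h]
  · simp only [cloudMeasure, lintegral_smul_measure, lintegral_finsetSum_measure,
      lintegral_dirac]
    refine ENNReal.mul_lt_top (by simp [ENNReal.inv_lt_top, hN]) ?_
    refine ENNReal.sum_lt_top.2 fun j _ => ?_
    exact ENNReal.rpow_lt_top_of_nonneg (by linarith) (edist_ne_top _ _)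

/-- The point cloud `(1/N) ∑ⱼ δ_{x j}` as an element of `𝒫_p(X)`. -/
def cloud {p : ℝ} (hp : 1 ≤ p) {X : Type u} [MetricSpace X] [MeasurableSpace X] [BorelSpace X]
    {N : ℕ} (hN : 0 < N) (x : Fin N → X) : PSpace p X :=
  ⟨cloudMeasure x, cloudMeasure_mem hp hN x⟩

/-- The point mass `δ_x` as an element of `𝒫_p(X)`. -/
def pointMass {p : ℝ} (hp : 1 ≤ p) {X : Type u} [MetricSpace X] [MeasurableSpace X] [BorelSpace X]
    (x : X) : PSpace p X :=
  ⟨Measure.dirac x, by simpa [cloudMeasure] using cloudMeasure_mem hp one_pos fun _ : Fin 1 => x⟩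

theorem wDist_dirac_self {p : ℝ} (hp : 1 ≤ p) {X : Type u} [MetricSpace X] [MeasurableSpace X]
    [BorelSpace X] (x : X) : wDist p (Measure.dirac x) (Measure.dirac x) = 0 := by
  have hγ : Measure.dirac (x, x) ∈ couplings (Measure.dirac x) (Measure.dirac x) :=
    ⟨Measure.map_dirac' measurable_fst (x, x), Measure.map_dirac' measurable_snd (x, x)⟩
  have h : ∫⁻ z, edist z.1 z.2 ^ p ∂(Measure.dirac (x, x)) = 0 := by
    rw [lintegral_dirac, edist_self, ENNReal.zero_rpow_of_pos (by linarith)]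
  have hinf : (⨅ γ ∈ couplings (Measure.dirac x) (Measure.dirac x),
      ∫⁻ z, edist z.1 z.2 ^ p ∂γ) = 0 := le_antisymm ((iInf₂_le _ hγ).trans h.le) zero_le
  have hp' : (0 : ℝ) < 1 / p := by positivity
  rw [wDist, hinf, ENNReal.zero_rpow_of_pos hp', ENNReal.toReal_zero]

/-! ## Internal measures and Loeb measures -/

section Loeb

variable {ω : Ultrafilter ℕ} {X : ℕ → Type u} [∀ i, MetricSpace (X i)]
  [∀ i, MeasurableSpace (X i)] {p : ℝ}

/-- The ultraproduct of the Borel `σ`-algebras. -/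
abbrev InternalBorel (ω : Ultrafilter ℕ) (X : ℕ → Type u) [∀ i, MeasurableSpace (X i)] : Type u :=
  UProd ω fun i => {B : Set (X i) // MeasurableSet B}

/-- The subset `{[(x i)] | x i ∈ B i ω-almost surely}` of the ultraproduct given by `[(B i)]`. -/
def InternalBorel.toSet (B : InternalBorel ω X) : Set (UProd ω X) :=
  {x | Quotient.liftOn₂ x B (fun x B => ∀ᶠ i in (ω : Filter ℕ), x i ∈ (B i).1)
    fun _ _ _ _ hx hB => propext (eventually_congr (by
      filter_upwards [hx, hB] with i h₁ h₂
      rw [h₁, h₂]))}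

/-- The hyperreal `μ^ω(B^ω) = [(μ i (B i))]`. -/
def internalMeasure (μ : UProd ω fun i => PSpace p (X i)) (B : InternalBorel ω X) : Hyper ω :=
  UProd.map₂ (fun _ m S => m.1.real S.1) μ B

/-- The premeasure `A ↦ st (μ^ω(A))` on internal Borel sets, and `∞` on all other sets. (The
infimum is over the representations of `A` as an internal Borel set, of which there is at most
one.) -/
def loebPremeasure (μ : UProd ω fun i => PSpace p (X i)) (A : Set (UProd ω X)) : ℝ≥0∞ :=
  ⨅ (B : InternalBorel ω X) (_ : B.toSet = A), ENNReal.ofReal (st (internalMeasure μ B))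

theorem loebPremeasure_empty (μ : UProd ω fun i => PSpace p (X i)) : loebPremeasure μ ∅ = 0 := by
  refine le_antisymm ?_ zero_le
  refine (iInf₂_le (UProd.mk ω fun i => ⟨∅, MeasurableSet.empty⟩) ?_).trans ?_
  · refine Set.eq_empty_of_forall_notMem ?_
    rintro ⟨x⟩ hx
    have hx' : ∀ᶠ i in (ω : Filter ℕ), x i ∈ (∅ : Set (X i)) := hx
    obtain ⟨i, hi⟩ := hx'.exists
    exact hi
  · obtain ⟨m⟩ := μ
    rw [st_eq_of_tendsto (a := 0), ENNReal.ofReal_zero]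
    refine (show Tendsto (fun i => (m i).1.real ∅) (ω : Filter ℕ) (𝓝 0) from ?_)
    simp

/-- The outer measure of the Carathéodory extension. -/
def loebOuterMeasure (μ : UProd ω fun i => PSpace p (X i)) : OuterMeasure (UProd ω X) :=
  OuterMeasure.ofFunction (loebPremeasure μ) (loebPremeasure_empty μ)

/-- The Loeb `σ`-algebra of `μ^ω`: the Carathéodory measurable sets. -/
@[reducible] def loebSigmaAlgebra (μ : UProd ω fun i => PSpace p (X i)) : MeasurableSpace (UProd ω X) :=
  (loebOuterMeasure μ).caratheodory

/-- The Loeb measure `μ_L` of `μ^ω`. -/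
def loebMeasure (μ : UProd ω fun i => PSpace p (X i)) : @Measure (UProd ω X) (loebSigmaAlgebra μ) :=
  @OuterMeasure.toMeasure (UProd ω X) (loebSigmaAlgebra μ) (loebOuterMeasure μ) le_rfl

variable [∀ i, BorelSpace (X i)] {e : ∀ i, X i}

/-- The preimage in the ultraproduct of a subset of the ultralimit. -/
def stPreimage (B : Set (Ultralimit ω e)) : Set (UProd ω X) :=
  Subtype.val '' (pushdown ⁻¹' B : Set (LimitedPart ω e))

/-- The pushforward of the Loeb measure of `μ^ω` to the ultralimit is well-defined (preimages of
Borel sets are Loeb measurable) and is equal to `ν`. -/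
def IsLoebPushforward (μ : UProd ω fun i => PSpace p (X i)) (ν : Measure (Ultralimit ω e)) : Prop :=
  ∀ B : Set (Ultralimit ω e), MeasurableSet B →
    MeasurableSet[loebSigmaAlgebra μ] (stPreimage B) ∧ loebMeasure μ (stPreimage B) = ν B

/-- The internal Borel set `X^ω \ B(e^ω, D) = [(X i \ B(e i, D))]`. -/
def ballCompl (ω : Ultrafilter ℕ) (e : ∀ i, X i) (D : ℝ) : InternalBorel ω X :=
  UProd.mk ω fun i => ⟨(Metric.ball (e i) D)ᶜ, Metric.isOpen_ball.measurableSet.compl⟩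

/-! ## The embedding of `𝒫_p(X̂)` and liftings -/

/-- `𝒫_p(X)^ω_lim`: the limited part of the ultraproduct of the `𝒫_p(X i)`, pointed at
`δ_{e i}`. -/
abbrev PLim (ω : Ultrafilter ℕ) (hp : 1 ≤ p) (e : ∀ i, X i) : Type u :=
  LimitedPart ω fun i => (pointMass hp (e i) : PSpace p (X i))

/-- The metric ultralimit of the Wasserstein spaces `𝒫_p(X i)`, pointed at `δ_{e i}`. -/
abbrev PHat (ω : Ultrafilter ℕ) (hp : 1 ≤ p) (e : ∀ i, X i) : Type u :=
  Ultralimit ω fun i => (pointMass hp (e i) : PSpace p (X i))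

/-- `[(δ_{e i})]` belongs to `𝒫_p(X)^ω_lim`. -/
theorem nearstandard_pointMass (ω : Ultrafilter ℕ) (hp : 1 ≤ p) (e : ∀ i, X i) :
    Nearstandard (hyperDist (UProd.mk ω fun i => (pointMass hp (e i) : PSpace p (X i)))
      (UProd.mk ω fun i => (pointMass hp (e i) : PSpace p (X i)))) := by
  refine ⟨0, show Tendsto (fun i => wDist p (Measure.dirac (e i)) (Measure.dirac (e i)))
    (ω : Filter ℕ) (𝓝 0) from ?_⟩
  simp only [wDist_dirac_self hp]
  exact tendsto_const_nhds

/-- `ν ∈ 𝒫_p(X)^ω_lim` represents the limit of the map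
`(1/N) ∑ⱼ δ_{pushdown [(x j i)]} ↦ pushdown [((1/N) ∑ⱼ δ_{x j i})]`, defined on point clouds, as
the clouds in `𝒫_p(X̂)` tend to `μ` in `W_p`. -/
def IsCloudLimit (hp : 1 ≤ p) (μ : PSpace p (Ultralimit ω e)) (ν : PLim ω hp e) : Prop :=
  ∀ ε : ℝ, 0 < ε → ∃ δ : ℝ, 0 < δ ∧ ∀ (N : ℕ) (hN : 0 < N) (x : Fin N → ∀ i, X i)
    (hx : ∀ j, Nearstandard (hyperDist (UProd.mk ω (x j)) (UProd.mk ω e))),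
    dist (cloud hp hN fun j => (pushdown ⟨UProd.mk ω (x j), hx j⟩ : Ultralimit ω e)) μ < δ →
    hyperDist (UProd.mk ω fun i => (cloud hp hN fun j => x j i : PSpace p (X i))) ν.1 <
      ((ε : ℝ) : Hyper ω)

open Classical in
/-- The canonical embedding `ι` of `𝒫_p(X̂)` into the ultralimit of the `𝒫_p(X i)`: the extension
by density of the map on point clouds. -/
def embedding (hp : 1 ≤ p) (μ : PSpace p (Ultralimit ω e)) : PHat ω hp e :=
  if h : ∃ ν : PLim ω hp e, IsCloudLimit hp μ ν then pushdown h.choose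
  else pushdown ⟨UProd.mk ω fun i => pointMass hp (e i), nearstandard_pointMass ω hp e⟩

/-- `ν ∈ 𝒫_p(X)^ω_lim` is a `Ŵ_p`-lifting of `μ ∈ 𝒫_p(X̂)`: `ι μ` is the class of `ν`. -/
def IsLifting (hp : 1 ≤ p) (ν : PLim ω hp e) (μ : PSpace p (Ultralimit ω e)) : Prop :=
  embedding hp μ = pushdown ν

end Loeb

end WassersteinUltralimit

end

open WassersteinUltralimit

namespace WassersteinUltralimit

universe u

/-! ### Couplings: completion, splitting along a cloud, gluing. -/

section Couplings

variable {X : Type u}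

/-! The embedding is given by an arbitrary choice of a cloud limit. So two facts are needed: the
internal measure is itself a cloud limit of its Loeb pushforward `ν`, and cloud limits of `ν` are
unique up to infinitesimal distance.

For the first (`eventually_wDist_cloud_lt`), let a cloud lie within `s` of `ν`. Radon regularity
yields finitely many disjoint shells of radius below `s / 3` that carry almost all of `ν`. A shell
is cut out by strict inequalities between distances, which pass from standard parts to `ω`-almost
all `i`. Its preimage therefore lies in the internal shell with the same radii and with
representatives of the same centres, and the Loeb outer measure gives `ν (shell) ≤ st [m i
(shell)]`. This one inequality suffices: the masses that a near-optimal coupling sends from cloud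
points to shells, shrunk by a factor `t < 1`, fit into the shells of `m i`. They form a partial
coupling of almost full mass at almost the same cost. The remainder is coupled independently. It is
small and, since `m i` lives on a ball of radius `D`, cheap. In total the lifted cloud is within `3
* s` of `m i`.

For the second, `ν` has bounded support, so clouds approximate it (`exists_cloud_near`). This also
keeps the cloud-limit condition from being vacuous. Two cloud limits are then compared through a
common cloud (`wDist_lt_of_cloud`); gluing along finitely many atoms needs no disintegration
theorem. -/

theorem edist_rpow_le {p : ℝ} (hp : 1 ≤ p) [MetricSpace X] (a y z : X) :
    edist y z ^ p ≤ 2 ^ (p - 1) * (edist a y ^ p + edist a z ^ p) :=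
  (ENNReal.rpow_le_rpow (edist_triangle_left y z a) (by linarith)).trans
    (ENNReal.rpow_add_le_mul_rpow_add_rpow _ _ hp)

variable [MeasurableSpace X]

theorem cloudMeasure_singleton [MeasurableSingletonClass X] [DecidableEq X] {N : ℕ}
    (x : Fin N → X) (a : X) :
    cloudMeasure x {a} = (N : ℝ≥0∞)⁻¹ * (Finset.univ.filter fun j => x j = a).card := by
  simp only [cloudMeasure, Measure.smul_apply, Measure.finsetSum_apply, smul_eq_mul]
  congr 1
  rw [Finset.card_filter, Nat.cast_sum]
  refine Finset.sum_congr rfl fun j _ => ?_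
  rw [Measure.dirac_apply' _ (measurableSet_singleton a)]
  by_cases h : x j = a <;> simp [Set.indicator, h]

theorem cloudMeasure_compl_range [MeasurableSingletonClass X] {N : ℕ} (x : Fin N → X) :
    cloudMeasure x (Set.range x)ᶜ = 0 := by
  simp only [cloudMeasure, Measure.smul_apply, Measure.finsetSum_apply, smul_eq_mul]
  rw [Finset.sum_eq_zero, mul_zero]
  intro j _
  rw [Measure.dirac_apply' _ (Set.finite_range x).measurableSet.compl]
  simp

theorem lintegral_fst_prod {Y : Type*} [MeasurableSpace Y] {α : Measure X} {β : Measure Y}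
    [SFinite β] {f : X → ℝ≥0∞} (hf : Measurable f) :
    ∫⁻ z, f z.1 ∂(α.prod β) = β Set.univ * ∫⁻ x, f x ∂α := by
  rw [← lintegral_map hf measurable_fst, Measure.map_fst_prod, lintegral_smul_measure, smul_eq_mul]

theorem lintegral_snd_prod {Y : Type*} [MeasurableSpace Y] {α : Measure Y} {β : Measure X}
    [SFinite α] [SFinite β] {f : X → ℝ≥0∞} (hf : Measurable f) :
    ∫⁻ z, f z.2 ∂(α.prod β) = α Set.univ * ∫⁻ x, f x ∂β := by
  rw [← lintegral_map hf measurable_snd, Measure.map_snd_prod, lintegral_smul_measure, smul_eq_mul]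

variable [MetricSpace X]

/-- A partial coupling extends to a coupling by coupling what is left independently. -/
theorem exists_coupling_of_le {p : ℝ} (hp : 0 ≤ p) {α β : Measure X} [IsProbabilityMeasure α]
    [IsProbabilityMeasure β] {γ : Measure (X × X)} (h₁ : γ.map Prod.fst ≤ α)
    (h₂ : γ.map Prod.snd ≤ β) (e : X) (R : ℝ≥0∞) (hα : ∀ᵐ x ∂α, edist x e ≤ R)
    (hβ : ∀ᵐ x ∂β, edist x e ≤ R) :
    ∃ γ' ∈ couplings α β, ∫⁻ z, edist z.1 z.2 ^ p ∂γ' ≤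
      ∫⁻ z, edist z.1 z.2 ^ p ∂γ + (1 - γ Set.univ) * (R + R) ^ p := by
  have m₁ : γ.map Prod.fst Set.univ = γ Set.univ := by
    rw [Measure.map_apply measurable_fst MeasurableSet.univ, Set.preimage_univ]
  have m₂ : γ.map Prod.snd Set.univ = γ Set.univ := by
    rw [Measure.map_apply measurable_snd MeasurableSet.univ, Set.preimage_univ]
  have hm : γ Set.univ ≤ 1 := by rw [← m₁, ← measure_univ (μ := α)]; exact h₁ _
  have hmt : γ Set.univ ≠ ∞ := ne_top_of_le_ne_top ENNReal.one_ne_top hm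
  have : IsFiniteMeasure γ := ⟨hmt.lt_top⟩
  have hα' := Measure.sub_add_cancel_of_le h₁
  have hβ' := Measure.sub_add_cancel_of_le h₂
  set α' := α - γ.map Prod.fst
  set β' := β - γ.map Prod.snd
  have uα : α' Set.univ = 1 - γ Set.univ := by
    refine ENNReal.eq_sub_of_add_eq hmt ?_
    rw [← m₁, ← Measure.add_apply, hα', measure_univ]
  have uβ : β' Set.univ = 1 - γ Set.univ := by
    refine ENNReal.eq_sub_of_add_eq hmt ?_
    rw [← m₂, ← Measure.add_apply, hβ', measure_univ]
  have lα : α' ≤ α := by rw [← hα']; exact Measure.le_add_right le_rfl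
  have lβ : β' ≤ β := by rw [← hβ']; exact Measure.le_add_right le_rfl
  have fα : IsFiniteMeasure α' := isFiniteMeasure_of_le α lα
  have fβ : IsFiniteMeasure β' := isFiniteMeasure_of_le β lβ
  have hrt : 1 - γ Set.univ ≠ ∞ := ne_top_of_le_ne_top ENNReal.one_ne_top tsub_le_self
  set r := 1 - γ Set.univ
  -- Both remainders have mass `r`, so the marginals of `α'.prod β'` are `r` times the remainders,
  -- and `r⁻¹` corrects this. For `r = 0` the factor `r⁻¹ * r` is `0`, but then the remainders
  -- vanish too.
  have key : ∀ {ρ : Measure X}, ρ Set.univ = r → (r⁻¹ * r) • ρ = ρ := by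
    intro ρ hρ
    by_cases hr : r = 0
    · rw [hr, Measure.measure_univ_eq_zero] at hρ
      rw [hρ, smul_zero]
    · rw [ENNReal.inv_mul_cancel hr hrt, one_smul]
  refine ⟨γ + r⁻¹ • α'.prod β', ⟨?_, ?_⟩, ?_⟩
  · rw [Measure.map_add _ _ measurable_fst, Measure.map_smul, Measure.map_fst_prod, smul_smul, uβ,
      key uα, add_comm, hα']
  · rw [Measure.map_add _ _ measurable_snd, Measure.map_smul, Measure.map_snd_prod, smul_smul, uα,
      key uβ, add_comm, hβ']
  · rw [lintegral_add_measure, lintegral_smul_measure]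
    gcongr
    have hb : ∫⁻ z, edist z.1 z.2 ^ p ∂(α'.prod β') ≤ (R + R) ^ p * (r * r) := by
      have : (R + R) ^ p * (r * r) = ∫⁻ _, (R + R) ^ p ∂(α'.prod β') := by
        rw [lintegral_const, ← Set.univ_prod_univ, Measure.prod_prod, uα, uβ]
      rw [this]
      refine lintegral_mono_ae ?_
      filter_upwards [Measure.quasiMeasurePreserving_fst.ae (lα.absolutelyContinuous.ae_le hα),
        Measure.quasiMeasurePreserving_snd.ae (lβ.absolutelyContinuous.ae_le hβ)] with z h h'
      exact ENNReal.rpow_le_rpow ((edist_triangle_right _ _ e).trans (add_le_add h h')) hp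
    refine (mul_le_mul_right hb _).trans ?_
    by_cases hr : r = 0
    · simp [hr]
    · rw [mul_left_comm, ← mul_assoc _ r, ENNReal.inv_mul_cancel hr hrt, one_mul, mul_comm]

theorem wDist_lt_of_coupling {p : ℝ} (hp : 1 ≤ p) {α β : Measure X} {γ : Measure (X × X)}
    (hγ : γ ∈ couplings α β) {ε : ℝ} (h : ∫⁻ z, edist z.1 z.2 ^ p ∂γ < ENNReal.ofReal ε ^ p) :
    wDist p α β < ε := by
  have hp0 : 0 < p := by linarith
  refine ENNReal.toReal_lt_of_lt_ofReal ?_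
  rw [one_div, ENNReal.rpow_inv_lt_iff hp0]
  exact (iInf₂_le γ hγ).trans_lt h


theorem lintegral_edist_rpow_lt_top {p : ℝ} (hp : 1 ≤ p) (μ : PSpace p X) (a : X) :
    ∫⁻ y, edist a y ^ p ∂μ.1 < ∞ := by
  obtain ⟨μ, hμ, -, b, hb⟩ := μ
  simp only [edist_comm _ b] at hb
  refine (lintegral_mono fun y => edist_rpow_le hp b a y).trans_lt ?_
  have h2 : (2 : ℝ≥0∞) ^ (p - 1) ≠ ∞ := ENNReal.rpow_ne_top_of_nonneg (by linarith) (by simp)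
  have ha : edist b a ^ p ≠ ∞ := ENNReal.rpow_ne_top_of_nonneg (by linarith) (edist_ne_top _ _)
  rw [lintegral_const_mul' _ _ h2, lintegral_add_left measurable_const, lintegral_const,
    measure_univ, mul_one]
  exact ENNReal.mul_lt_top h2.lt_top (ENNReal.add_lt_top.2 ⟨ha.lt_top, hb⟩)

variable [BorelSpace X]

theorem measurable_edist_rpow (p : ℝ) (a : X) : Measurable fun y => edist a y ^ p :=
  (continuous_const.edist continuous_id).measurable.pow_const p

/-- A coupling of a point cloud with `β` splits `β` into one piece for each point of the cloud. -/
theorem exists_disintegration {p : ℝ} {N : ℕ} (x : Fin N → X) {β : Measure X}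
    {γ : Measure (X × X)} (hγ : γ ∈ couplings (cloudMeasure x) β) :
    ∃ b : Fin N → Measure X, ∑ j, b j = β ∧ (∀ j, b j Set.univ = (N : ℝ≥0∞)⁻¹) ∧
      ∑ j, ∫⁻ y, edist (x j) y ^ p ∂(b j) = ∫⁻ z, edist z.1 z.2 ^ p ∂γ := by
  classical
  set fib : X → Set (X × X) := fun a => Prod.fst ⁻¹' {a} with hfib
  have hfm : ∀ a, MeasurableSet (fib a) := fun a => measurable_fst (measurableSet_singleton a)
  -- Points of the cloud may coincide; the fibre over a point is shared equally among the indices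
  -- that have it as value.
  set mult : X → ℝ≥0∞ := fun a => ((Finset.univ.filter fun j => x j = a).card : ℝ≥0∞) with hmult
  have hm0 : ∀ j, mult (x j) ≠ 0 := fun j => by
    simp only [hmult, ne_eq, Nat.cast_eq_zero, Finset.card_eq_zero]
    exact Finset.ne_empty_of_mem (a := j) (by simp)
  have hmt : ∀ a, mult a ≠ ∞ := fun a => ENNReal.natCast_ne_top _
  have hdecomp : ∑ j, (mult (x j))⁻¹ • γ.restrict (fib (x j)) = γ := by
    rw [← Finset.sum_fiberwise_of_maps_to (s := Finset.univ) (t := Finset.univ.image x) (g := x)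
      fun j hj => Finset.mem_image_of_mem x hj]
    have h₁ : ∀ a ∈ Finset.univ.image x, (∑ j ∈ Finset.univ.filter fun j => x j = a,
        (mult (x j))⁻¹ • γ.restrict (fib (x j))) = γ.restrict (fib a) := by
      intro a ha
      obtain ⟨k, -, rfl⟩ := Finset.mem_image.1 ha
      rw [Finset.sum_congr rfl (g := fun _ => (mult (x k))⁻¹ • γ.restrict (fib (x k)))
        fun j hj => by rw [(Finset.mem_filter.1 hj).2], Finset.sum_const,
        ← Nat.cast_smul_eq_nsmul ℝ≥0∞, smul_smul, ENNReal.mul_inv_cancel (hm0 k) (hmt _), one_smul]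
    rw [Finset.sum_congr rfl h₁]
    have h₂ : γ (⋃ a ∈ Finset.univ.image x, fib a)ᶜ = 0 := by
      have : (⋃ a ∈ Finset.univ.image x, fib a)ᶜ = Prod.fst ⁻¹' (Set.range x)ᶜ := by
        ext z; simp [hfib, eq_comm]
      rw [this, ← Measure.map_apply measurable_fst (Set.finite_range x).measurableSet.compl, hγ.1,
        cloudMeasure_compl_range]
    have h₃ : γ.restrict (⋃ a ∈ Finset.univ.image x, fib a) = γ :=
      Measure.restrict_eq_self_of_ae_mem (measure_eq_zero_iff_ae_notMem.1 h₂ |>.mono fun z hz => by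
        simpa using hz)
    conv_rhs => rw [← h₃]
    ext S hS
    rw [Measure.finsetSum_apply, Measure.restrict_apply hS, Set.inter_iUnion₂,
      measure_biUnion_finset (fun a _ b _ hab => ?_) fun a _ => hS.inter (hfm a)]
    · exact Finset.sum_congr rfl fun a _ => Measure.restrict_apply hS
    · exact Set.disjoint_left.2 fun z hz hz' => hab (hz.2.symm.trans hz'.2)
  refine ⟨fun j => (mult (x j))⁻¹ • (γ.restrict (fib (x j))).map Prod.snd, ?_, fun j => ?_, ?_⟩
  · rw [← hγ.2]
    conv_rhs => rw [← hdecomp]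
    rw [Measure.map_finset_sum' measurable_snd.aemeasurable]
    exact Finset.sum_congr rfl fun j _ => (Measure.map_smul ..).symm
  · rw [Measure.smul_apply, Measure.map_apply measurable_snd MeasurableSet.univ, Set.preimage_univ,
      Measure.restrict_apply_univ, ← Measure.map_apply measurable_fst (measurableSet_singleton _),
      hγ.1, cloudMeasure_singleton, smul_eq_mul, mul_left_comm,
      ENNReal.inv_mul_cancel (hm0 j) (hmt _), mul_one]
  · conv_rhs => rw [← hdecomp]
    rw [lintegral_finsetSum_measure]
    refine Finset.sum_congr rfl fun j _ => ?_
    rw [lintegral_smul_measure, lintegral_smul_measure, lintegral_map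
      (measurable_edist_rpow p (x j)) measurable_snd]
    congr 1
    refine setLIntegral_congr_fun (hfm _) fun z hz => ?_
    rw [show z.1 = x j from hz]

/-- The detour through `a` bounds the cost by functions of one coordinate each. These are
measurable, while the distance need not be measurable for the product `σ`-algebra when `X` is not
separable. -/
theorem lintegral_edist_prod_le {p : ℝ} (hp : 1 ≤ p) (a : X) (α β : Measure X)
    [SFinite α] [SFinite β] :
    ∫⁻ z, edist z.1 z.2 ^ p ∂(α.prod β) ≤ 2 ^ (p - 1) *
      (β Set.univ * ∫⁻ y, edist a y ^ p ∂α + α Set.univ * ∫⁻ y, edist a y ^ p ∂β) := by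
  have hm := measurable_edist_rpow (X := X) p a
  calc ∫⁻ z, edist z.1 z.2 ^ p ∂(α.prod β)
      ≤ ∫⁻ z, 2 ^ (p - 1) * (edist a z.1 ^ p + edist a z.2 ^ p) ∂(α.prod β) :=
        lintegral_mono fun z => edist_rpow_le hp a z.1 z.2
    _ = _ := by
      have h₁ : Measurable fun z : X × X => edist a z.1 ^ p := hm.comp measurable_fst
      rw [lintegral_const_mul' _ _ (ENNReal.rpow_ne_top_of_nonneg (by linarith) (by simp)),
        lintegral_add_left h₁, lintegral_fst_prod hm, lintegral_snd_prod hm]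

/-- Gluing of two couplings along a point cloud. -/
theorem exists_coupling_glue {p : ℝ} (hp : 1 ≤ p) {N : ℕ} (hN : 0 < N) (x : Fin N → X)
    {α β : Measure X} {γ₁ γ₂ : Measure (X × X)}
    (h₁ : γ₁ ∈ couplings (cloudMeasure x) α) (h₂ : γ₂ ∈ couplings (cloudMeasure x) β) :
    ∃ γ ∈ couplings α β, ∫⁻ z, edist z.1 z.2 ^ p ∂γ ≤
      2 ^ (p - 1) * (∫⁻ z, edist z.1 z.2 ^ p ∂γ₁ + ∫⁻ z, edist z.1 z.2 ^ p ∂γ₂) := by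
  obtain ⟨a, ha, ha1, hac⟩ := exists_disintegration (p := p) x h₁
  obtain ⟨b, hb, hb1, hbc⟩ := exists_disintegration (p := p) x h₂
  have hN0 : (N : ℝ≥0∞) ≠ 0 := by exact_mod_cast hN.ne'
  have hNi : (N : ℝ≥0∞)⁻¹ < ∞ := by simp [hN]
  have : ∀ j, IsFiniteMeasure (a j) := fun j => ⟨by rw [ha1]; exact hNi⟩
  have : ∀ j, IsFiniteMeasure (b j) := fun j => ⟨by rw [hb1]; exact hNi⟩
  have hNN := ENNReal.mul_inv_cancel hN0 (ENNReal.natCast_ne_top N)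
  -- The pieces `a j` and `b j` both have mass `1/N`, so the factor `N` makes them the marginals of
  -- the `j`-th summand.
  refine ⟨∑ j, (N : ℝ≥0∞) • (a j).prod (b j), ⟨?_, ?_⟩, ?_⟩
  · rw [Measure.map_finset_sum' measurable_fst.aemeasurable, ← ha]
    refine Finset.sum_congr rfl fun j _ => ?_
    rw [Measure.map_smul, Measure.map_fst_prod, smul_smul, hb1, hNN, one_smul]
  · rw [Measure.map_finset_sum' measurable_snd.aemeasurable, ← hb]
    refine Finset.sum_congr rfl fun j _ => ?_
    rw [Measure.map_smul, Measure.map_snd_prod, smul_smul, ha1, hNN, one_smul]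
  · rw [lintegral_finsetSum_measure, ← hac, ← hbc, ← Finset.sum_add_distrib, Finset.mul_sum]
    refine Finset.sum_le_sum fun j _ => ?_
    rw [lintegral_smul_measure, smul_eq_mul]
    refine (mul_le_mul_right (lintegral_edist_prod_le hp (x j) (a j) (b j)) _).trans ?_
    rw [ha1, hb1, ← mul_add, mul_left_comm, ← mul_assoc _ _⁻¹, hNN, one_mul]

/-- A small `wDist` is informative only if the infimum is finite, as `toReal` sends `∞` to `0`. The
product coupling has finite cost because the `p`-th moments are finite. -/
theorem exists_coupling_of_wDist_lt {p : ℝ} (hp : 1 ≤ p) (α β : PSpace p X) {ε : ℝ}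
    (h : wDist p α.1 β.1 < ε) :
    ∃ γ ∈ couplings α.1 β.1, ∫⁻ z, edist z.1 z.2 ^ p ∂γ < ENNReal.ofReal ε ^ p := by
  have hp0 : 0 < p := by linarith
  have := α.2.1
  have := β.2.1
  obtain ⟨a⟩ : Nonempty X := ⟨α.2.2.2.choose⟩
  have hfin : (⨅ γ ∈ couplings α.1 β.1, ∫⁻ z, edist z.1 z.2 ^ p ∂γ) ≠ ∞ := by
    refine ne_top_of_le_ne_top ?_ ((iInf₂_le (α.1.prod β.1) ⟨?_, ?_⟩).trans
      (lintegral_edist_prod_le hp a α.1 β.1))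
    · have h₁ := (lintegral_edist_rpow_lt_top hp α a).ne
      have h₂ := (lintegral_edist_rpow_lt_top hp β a).ne
      simp only [measure_univ, one_mul]
      exact ENNReal.mul_ne_top (ENNReal.rpow_ne_top_of_nonneg (by linarith) (by simp))
        (ENNReal.add_ne_top.2 ⟨h₁, h₂⟩)
    · simp [Measure.map_fst_prod]
    · simp [Measure.map_snd_prod]
  have h' := (ENNReal.lt_ofReal_iff_toReal_lt (ENNReal.rpow_ne_top_of_nonneg (by positivity) hfin)).2 h
  rw [one_div, ENNReal.rpow_inv_lt_iff hp0] at h'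
  simpa only [iInf_lt_iff, exists_prop] using h'

end Couplings

/-! ### Disjoint shells cut out by strict inequalities. -/

section Shells

variable {Y : Type u} [PseudoMetricSpace Y] {n : ℕ} (y : Fin n → Y) (r : Fin n → ℝ)

/-- The `l`-th ball of a finite family with the earlier closed balls removed. -/
def shell (l : Fin n) : Set Y :=
  Metric.ball (y l) (r l) \ ⋃ k < l, Metric.closedBall (y k) (r k)

/-- Removing closed balls from an open one leaves only strict inequalities, which survive the
passage from a limit along `ω` to almost all indices. -/
theorem mem_shell {y : Fin n → Y} {r : Fin n → ℝ} {l : Fin n} {x : Y} :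
    x ∈ shell y r l ↔ dist x (y l) < r l ∧ ∀ k < l, r k < dist x (y k) := by
  simp [shell]

theorem measurableSet_shell [MeasurableSpace Y] [BorelSpace Y] (l : Fin n) :
    MeasurableSet (shell y r l) :=
  Metric.isOpen_ball.measurableSet.diff
    (.iUnion fun _ => .iUnion fun _ => Metric.isClosed_closedBall.measurableSet)

theorem pairwise_disjoint_shell : Pairwise (Function.onFun Disjoint (shell y r)) := by
  intro k l hkl
  refine Set.disjoint_left.2 fun x hk hl => ?_
  rw [mem_shell] at hk hl
  rcases lt_or_gt_of_ne hkl with h | h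
  · exact (hl.2 k h).not_gt hk.1
  · exact (hk.2 l h).not_gt hl.1

theorem sum_restrict_shell_le [MeasurableSpace Y] [BorelSpace Y] (μ : Measure Y) :
    ∑ l, μ.restrict (shell y r l) ≤ μ := by
  refine Measure.le_iff.2 fun S hS => ?_
  rw [Measure.finsetSum_apply]
  simp only [Measure.restrict_apply hS]
  rw [← measure_biUnion_finset (fun k _ l _ hkl => ((pairwise_disjoint_shell y r hkl).mono
    Set.inter_subset_right Set.inter_subset_right)) fun l _ => hS.inter (measurableSet_shell y r l)]
  exact measure_mono (Set.iUnion₂_subset fun l _ => Set.inter_subset_left)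

theorem sum_measure_shell_le [MeasurableSpace Y] [BorelSpace Y] (μ : Measure Y) :
    ∑ l, μ (shell y r l) ≤ μ Set.univ := by
  simpa using sum_restrict_shell_le y r μ Set.univ

/-- Shells of small radius exhaust a Radon probability measure up to a small error. -/
theorem exists_shells [MeasurableSpace Y] [BorelSpace Y] (μ : Measure Y)
    [IsProbabilityMeasure μ] (hreg : μ.InnerRegular) {U : Set Y} (hU : MeasurableSet U)
    (hμU : μ U = 1) {η : ℝ} (hη : 0 < η) {κ : ℝ≥0∞} (hκ : κ ≠ 0) :
    ∃ (n : ℕ) (y : Fin n → Y) (r : Fin n → ℝ), (∀ l, y l ∈ U) ∧ (∀ l, r l < η) ∧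
      1 - κ ≤ ∑ l, μ (shell y r l) := by
  obtain ⟨K, hKU, hK, hμK⟩ := hU.exists_lt_isCompact (μ := μ) (r := 1 - κ)
    (by rw [hμU]; exact ENNReal.sub_lt_self ENNReal.one_ne_top one_ne_zero hκ)
  -- Only countably many spheres about `y` have positive mass, so some radius in `(η/2, η)` gives a
  -- null sphere.
  have hrad : ∀ y : Y, ∃ t, 0 < t ∧ t < η ∧ μ {x | dist x y = t} = 0 := by
    intro y
    have hc : {t | 0 < μ {x | dist x y = t}}.Countable :=
      Measure.countable_meas_level_set_pos (continuous_id.dist continuous_const).measurable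
    obtain ⟨t, ht, h0, h1⟩ := (hc.dense_compl ℝ).exists_mem_open isOpen_Ioo
      ⟨η / 2, half_pos hη, half_lt_self hη⟩
    exact ⟨t, h0, h1, by simpa using ht⟩
  choose ρ hρ0 hρη hρμ using hrad
  obtain ⟨t, htK, hKt⟩ := hK.elim_nhds_subcover (fun y => Metric.ball y (ρ y))
    fun y _ => Metric.ball_mem_nhds y (hρ0 y)
  let y : Fin t.card → Y := fun l => (t.equivFin.symm l).1
  refine ⟨t.card, y, fun l => ρ (y l), fun l => hKU (htK _ (t.equivFin.symm l).2),
    fun l => hρη _, ?_⟩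
  have hcov : K ⊆ (⋃ l, shell y (fun l => ρ (y l)) l) ∪ ⋃ l, {x | dist x (y l) = ρ (y l)} := by
    intro x hx
    have hex : ∃ l, dist x (y l) ≤ ρ (y l) := by
      obtain ⟨z, hz, hxz⟩ := Set.mem_iUnion₂.1 (hKt hx)
      refine ⟨t.equivFin ⟨z, hz⟩, ?_⟩
      simpa [y] using (Metric.mem_ball.1 hxz).le
    -- At the least index whose closed ball contains `x`, either `x` is in the shell or it is on the
    -- null sphere.
    obtain ⟨l, hl, hmin⟩ := WellFounded.has_min (wellFounded_lt (α := Fin t.card))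
      {l | dist x (y l) ≤ ρ (y l)} hex
    rcases lt_or_eq_of_le (show dist x (y l) ≤ ρ (y l) from hl) with h | h
    · refine Or.inl (Set.mem_iUnion.2 ⟨l, mem_shell.2 ⟨h, fun k hk => ?_⟩⟩)
      exact not_le.1 fun hle => hmin k hle hk
    · exact Or.inr (Set.mem_iUnion.2 ⟨l, h⟩)
  refine hμK.le.trans ((measure_mono hcov).trans ((measure_union_le _ _).trans ?_))
  rw [measure_iUnion_null fun l => hρμ (y l), add_zero]
  exact measure_iUnion_fintype_le _ _

end Shells

/-! ### Loeb measures and the ultralimit -/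

section Loeb

variable {ω : Ultrafilter ℕ} {X : ℕ → Type u} [∀ i, MetricSpace (X i)] {e : ∀ i, X i}

theorem tendsto_dist_pushdown {x y : ∀ i, X i}
    (hx : Nearstandard (hyperDist (UProd.mk ω x) (UProd.mk ω e)))
    (hy : Nearstandard (hyperDist (UProd.mk ω y) (UProd.mk ω e))) :
    Tendsto (fun i => dist (x i) (y i)) (ω : Filter ℕ)
      (𝓝 (dist (pushdown ⟨UProd.mk ω x, hx⟩ : Ultralimit ω e) (pushdown ⟨UProd.mk ω y, hy⟩))) :=
  tendsto_hyperDist (e := e) ⟨UProd.mk ω x, hx⟩ ⟨UProd.mk ω y, hy⟩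

theorem nearstandard_base (ω : Ultrafilter ℕ) (e : ∀ i, X i) :
    Nearstandard (hyperDist (UProd.mk ω e) (UProd.mk ω e)) := by
  refine ⟨0, show Tendsto (fun i => dist (e i) (e i)) (ω : Filter ℕ) (𝓝 0) from ?_⟩
  simp

/-- The base point of the ultralimit. -/
def basePoint (ω : Ultrafilter ℕ) (e : ∀ i, X i) : Ultralimit ω e :=
  pushdown ⟨UProd.mk ω e, nearstandard_base ω e⟩

theorem exists_pushdown_eq (z : Ultralimit ω e) :
    ∃ (x : ∀ i, X i) (hx : Nearstandard (hyperDist (UProd.mk ω x) (UProd.mk ω e))),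
      pushdown ⟨UProd.mk ω x, hx⟩ = z := by
  obtain ⟨⟨⟨x⟩, hx⟩⟩ := z
  exact ⟨x, hx, rfl⟩

variable [∀ i, MeasurableSpace (X i)] {p : ℝ}

/-- A single internal set is an admissible cover in the outer measure, so this upper bound needs no
countable additivity of the premeasure. -/
theorem measure_le_of_stPreimage_subset {μ : UProd ω fun i => PSpace p (X i)}
    {ν : Measure (Ultralimit ω e)} (hν : IsLoebPushforward μ ν) {S : Set (Ultralimit ω e)}
    (hS : MeasurableSet S) {B : InternalBorel ω X} (hB : stPreimage S ⊆ B.toSet) :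
    ν S ≤ ENNReal.ofReal (st (internalMeasure μ B)) := by
  obtain ⟨hm, heq⟩ := hν S hS
  rw [← heq, loebMeasure, @toMeasure_apply _ (loebSigmaAlgebra μ) _ _ _ hm]
  exact (measure_mono hB).trans ((OuterMeasure.ofFunction_le _).trans (by
    unfold loebPremeasure
    exact iInf₂_le B (rfl : B.toSet = B.toSet)))

/-- The masses `m i (B i)` lie in `[0, 1]`, so they converge along `ω` to their standard part; a
strict lower bound for the limit holds almost surely. -/
theorem eventually_lt_measure {m : ∀ i, PSpace p (X i)} {ν : Measure (Ultralimit ω e)}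
    (hν : IsLoebPushforward (UProd.mk ω m) ν) {S : Set (Ultralimit ω e)} (hS : MeasurableSet S)
    {B : ∀ i, Set (X i)} (hBm : ∀ i, MeasurableSet (B i))
    (hB : ∀ (x : ∀ i, X i) (hx : Nearstandard (hyperDist (UProd.mk ω x) (UProd.mk ω e))),
      pushdown ⟨UProd.mk ω x, hx⟩ ∈ S → ∀ᶠ i in (ω : Filter ℕ), x i ∈ B i)
    {a : ℝ≥0∞} (ha : a < ν S) : ∀ᶠ i in (ω : Filter ℕ), a < (m i).1 (B i) := by
  have hle := measure_le_of_stPreimage_subset hν hS (B := UProd.mk ω fun i => ⟨B i, hBm i⟩) (by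
    rintro _ ⟨⟨⟨x⟩, hx⟩, hxS, rfl⟩
    exact hB x hx hxS)
  have hns : Nearstandard (internalMeasure (UProd.mk ω m) (UProd.mk ω fun i => ⟨B i, hBm i⟩)) :=
    exists_tendsto_of_bounded ω (fun i => (m i).1.real (B i)) 1 (.of_forall fun i => by
      have := (m i).2.1
      exact ⟨measureReal_nonneg, measureReal_le_one⟩)
  have ht : Tendsto (fun i => (m i).1.real (B i)) (ω : Filter ℕ) (𝓝 _) := tendsto_st hns
  filter_upwards [(ENNReal.tendsto_ofReal ht).eventually (lt_mem_nhds (ha.trans_le hle))] with i hi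
  have := (m i).2.1
  rwa [ofReal_measureReal] at hi

variable [∀ i, BorelSpace (X i)]

/-- The factor `t < 1` buys the strict inequality required to descend from the standard part; a null
shell, where it buys nothing, is trivial. -/
theorem eventually_mul_measure_shell_le {m : ∀ i, PSpace p (X i)} {ν : Measure (Ultralimit ω e)}
    [IsFiniteMeasure ν] (hν : IsLoebPushforward (UProd.mk ω m) ν) {n : ℕ} (y : Fin n → ∀ i, X i)
    (hy : ∀ l, Nearstandard (hyperDist (UProd.mk ω (y l)) (UProd.mk ω e))) (r : Fin n → ℝ)
    {t : ℝ≥0∞} (ht : t < 1) (l : Fin n) :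
    ∀ᶠ i in (ω : Filter ℕ), t * ν (shell (fun l => pushdown ⟨UProd.mk ω (y l), hy l⟩) r l) ≤
      (m i).1 (shell (fun l => y l i) r l) := by
  rcases eq_or_ne (ν (shell (fun l => pushdown ⟨UProd.mk ω (y l), hy l⟩) r l)) 0 with h0 | h0
  · simp [h0]
  refine (eventually_lt_measure hν
    (measurableSet_shell (fun l => (pushdown ⟨UProd.mk ω (y l), hy l⟩ : Ultralimit ω e)) r l)
    (fun i => measurableSet_shell (fun l => y l i) r l) ?_ ?_).mono fun i hi => hi.le
  · intro x hx hxS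
    obtain ⟨h₁, h₂⟩ := mem_shell.1 hxS
    have h₂' : ∀ᶠ i in (ω : Filter ℕ), ∀ k, k < l → r k < dist (x i) (y k i) :=
      eventually_all.2 fun k => by
        by_cases hk : k < l
        · exact ((tendsto_dist_pushdown hx (hy k)).eventually (lt_mem_nhds (h₂ k hk))).mono
            fun i hi _ => hi
        · exact .of_forall fun i hk' => absurd hk' hk
    filter_upwards [(tendsto_dist_pushdown hx (hy l)).eventually (gt_mem_nhds h₁), h₂'] with i hi hi'
    exact mem_shell.2 ⟨hi, hi'⟩
  · conv_rhs => rw [← one_mul (ν _)]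
    exact ENNReal.mul_lt_mul_left h0 (measure_ne_top _ _) ht

/-- A limit point at distance more than `D` has representatives almost surely outside the open
`D`-balls, in an internal null set. The ball must be closed, as distances below `D` may have
standard part `D`. -/
theorem measure_closedBall_eq_one {m : ∀ i, PSpace p (X i)} {D : ℝ}
    (hD : internalMeasure (UProd.mk ω m) (ballCompl ω e D) = 0) {ν : Measure (Ultralimit ω e)}
    [IsProbabilityMeasure ν] (hν : IsLoebPushforward (UProd.mk ω m) ν) :
    ν (Metric.closedBall (basePoint ω e) D) = 1 := by
  rw [← prob_compl_eq_zero_iff Metric.isClosed_closedBall.measurableSet]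
  refine le_antisymm ((measure_le_of_stPreimage_subset hν
    Metric.isClosed_closedBall.measurableSet.compl (B := ballCompl ω e D) ?_).trans ?_) zero_le
  · rintro _ ⟨⟨⟨x⟩, hx⟩, hxS, rfl⟩
    have hxS' : D < dist (pushdown ⟨UProd.mk ω x, hx⟩) (basePoint ω e) := by
      rw [← not_le]; exact hxS
    have : ∀ᶠ i in (ω : Filter ℕ), x i ∈ (Metric.ball (e i) D)ᶜ := by
      filter_upwards [(tendsto_dist_pushdown hx (nearstandard_base ω e)).eventually
        (lt_mem_nhds hxS')] with i hi h
      exact hi.not_gt h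
    exact this
  · rw [hD, st_eq_of_tendsto (a := 0), ENNReal.ofReal_zero]
    exact (tendsto_const_nhds : Tendsto (fun _ : ℕ => (0 : ℝ)) (ω : Filter ℕ) (𝓝 0))

theorem eventually_ae_dist_lt {m : ∀ i, PSpace p (X i)} {D : ℝ}
    (hD : internalMeasure (UProd.mk ω m) (ballCompl ω e D) = 0) :
    ∀ᶠ i in (ω : Filter ℕ), ∀ᵐ x ∂(m i).1, dist x (e i) < D := by
  have h : ∀ᶠ i in (ω : Filter ℕ), (m i).1.real (Metric.ball (e i) D)ᶜ = 0 := Germ.coe_eq.1 hD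
  filter_upwards [h] with i hi
  have := (m i).2.1
  rwa [measureReal_eq_zero_iff] at hi

end Loeb

/-! ### Transport plans and approximation by clouds. -/

section PartialCouplings

variable {X : Type u} [MeasurableSpace X]

theorem measure_smul_le_smul {a b : ℝ≥0∞} (h : a ≤ b) (ρ : Measure X) : a • ρ ≤ b • ρ :=
  fun _ => mul_le_mul_left h _

theorem map_fst_map_mk (a : X) (ρ : Measure X) :
    (ρ.map (Prod.mk a)).map Prod.fst = ρ Set.univ • Measure.dirac a := by
  rw [Measure.map_map measurable_fst measurable_prodMk_left]
  exact Measure.map_const ρ a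

theorem map_snd_map_mk (a : X) (ρ : Measure X) : (ρ.map (Prod.mk a)).map Prod.snd = ρ := by
  rw [Measure.map_map measurable_snd measurable_prodMk_left]
  exact Measure.map_id

variable [MetricSpace X] [BorelSpace X]

theorem ae_cloudMeasure {N : ℕ} (x : Fin N → X) {P : X → Prop} (h : ∀ j, P (x j)) :
    ∀ᵐ y ∂(cloudMeasure x), P y := by
  filter_upwards [measure_eq_zero_iff_ae_notMem.1 (cloudMeasure_compl_range x)] with y hy
  obtain ⟨j, rfl⟩ := not_not.1 hy
  exact h j

/-- A transport plan between the points of a cloud and the cells of a partition up to a small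
remainder yields a coupling. -/
theorem exists_coupling_of_plan {p : ℝ} (hp : 0 ≤ p) {N : ℕ} (x : Fin N → X)
    (m : Measure X) [IsProbabilityMeasure m] [IsProbabilityMeasure (cloudMeasure x)] {n : ℕ}
    (y : Fin n → X) (r : Fin n → ℝ) (q : Fin N → Fin n → ℝ≥0∞)
    (hq₁ : ∀ j, ∑ l, q j l ≤ (N : ℝ≥0∞)⁻¹) (hq₂ : ∀ l, ∑ j, q j l ≤ m (shell y r l))
    (M : Fin N → Fin n → ℝ≥0∞) (hM : ∀ j l, q j l ≠ 0 → ∀ z ∈ shell y r l, edist (x j) z ^ p ≤ M j l)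
    (e : X) (R : ℝ≥0∞) (hx : ∀ j, edist (x j) e ≤ R) (hm : ∀ᵐ z ∂m, edist z e ≤ R) :
    ∃ γ ∈ couplings (cloudMeasure x) m, ∫⁻ z, edist z.1 z.2 ^ p ∂γ ≤
      ∑ j, ∑ l, q j l * M j l + (1 - ∑ j, ∑ l, q j l) * (R + R) ^ p := by
  set A := shell y r with hA
  have hle : ∀ j l, q j l ≤ m (A l) := fun j l =>
    (Finset.single_le_sum (f := fun j => q j l) (fun _ _ => zero_le) (Finset.mem_univ j)).trans (hq₂ l)
  have hcancel : ∀ j l, q j l / m (A l) * m (A l) = q j l := fun j l =>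
    ENNReal.div_mul_cancel' (fun h => le_antisymm ((hle j l).trans h.le) zero_le)
      fun h => absurd h (measure_ne_top _ _)
  -- The mass `q j l` leaves `x j` and spreads over the cell `A l` in proportion to `m`; by
  -- `hcancel` a null cell receives none.
  set γ : Measure (X × X) :=
    ∑ j, ∑ l, (q j l / m (A l)) • (m.restrict (A l)).map (Prod.mk (x j)) with hγ
  have hfst : γ.map Prod.fst = ∑ j, (∑ l, q j l) • Measure.dirac (x j) := by
    rw [hγ, Measure.map_finset_sum' measurable_fst.aemeasurable]
    refine Finset.sum_congr rfl fun j _ => ?_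
    rw [Measure.map_finset_sum' measurable_fst.aemeasurable, Finset.sum_smul]
    refine Finset.sum_congr rfl fun l _ => ?_
    rw [Measure.map_smul, map_fst_map_mk, Measure.restrict_apply_univ, smul_smul, hcancel]
  have hsnd : γ.map Prod.snd = ∑ l, (∑ j, q j l / m (A l)) • m.restrict (A l) := by
    rw [hγ, Measure.map_finset_sum' measurable_snd.aemeasurable]
    simp only [Finset.sum_smul]
    rw [Finset.sum_comm]
    refine Finset.sum_congr rfl fun j _ => ?_
    rw [Measure.map_finset_sum' measurable_snd.aemeasurable]
    refine Finset.sum_congr rfl fun l _ => ?_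
    rw [Measure.map_smul, map_snd_map_mk]
  have hmass : γ Set.univ = ∑ j, ∑ l, q j l := by
    have : γ.map Prod.fst Set.univ = γ Set.univ := by
      rw [Measure.map_apply measurable_fst MeasurableSet.univ, Set.preimage_univ]
    rw [← this, hfst]
    simp [Measure.finsetSum_apply]
  obtain ⟨γ', hγ', hcost⟩ := exists_coupling_of_le hp (α := cloudMeasure x) (β := m) (γ := γ)
    (by
      rw [hfst, cloudMeasure, Finset.smul_sum]
      exact Finset.sum_le_sum fun j _ => measure_smul_le_smul (hq₁ j) _)
    (by
      rw [hsnd]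
      refine (Finset.sum_le_sum fun l _ => ?_).trans (sum_restrict_shell_le y r m)
      conv_rhs => rw [← one_smul ℝ≥0∞ (m.restrict (A l))]
      refine measure_smul_le_smul ?_ _
      simp only [div_eq_mul_inv]
      rw [← Finset.sum_mul, ← div_eq_mul_inv]
      exact ENNReal.div_le_of_le_mul (by rw [one_mul]; exact hq₂ l))
    e R (ae_cloudMeasure x hx) hm
  refine ⟨γ', hγ', hcost.trans ?_⟩
  rw [hmass]
  gcongr
  rw [hγ, lintegral_finsetSum_measure]
  refine Finset.sum_le_sum fun j _ => ?_
  rw [lintegral_finsetSum_measure]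
  refine Finset.sum_le_sum fun l _ => ?_
  rw [lintegral_smul_measure, smul_eq_mul]
  rcases eq_or_ne (q j l) 0 with h0 | h0
  · simp [h0]
  calc q j l / m (A l) * ∫⁻ z, edist z.1 z.2 ^ p ∂(m.restrict (A l)).map (Prod.mk (x j))
      ≤ q j l / m (A l) * (M j l * m (A l)) := by
        gcongr
        -- This direction of the change of variables holds without measurability of the distance.
        refine (lintegral_map_le _ _).trans ?_
        rw [← setLIntegral_const]
        exact setLIntegral_mono measurable_const (hM j l h0)
    _ = q j l * M j l := by rw [mul_comm (M j l), ← mul_assoc, hcancel]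

/-- Embed the disjoint union of the wanted fibres into `Fin N` and send the unused indices to
`none`. This allots `k l` points of a cloud to the cell `l`. -/
theorem exists_fibers {N n : ℕ} (k : Fin n → ℕ) (hk : ∑ l, k l ≤ N) :
    ∃ f : Fin N → Option (Fin n), ∀ l, (Finset.univ.filter fun j => f j = some l).card = k l := by
  have hcard : Fintype.card (Σ l, Fin (k l)) ≤ Fintype.card (Fin N) := by simpa using hk
  obtain ⟨φ⟩ := Function.Embedding.nonempty_of_card_le hcard
  refine ⟨Function.extend φ (fun s => some s.1) fun _ => none, fun l => ?_⟩
  have : (Finset.univ.filter fun j => Function.extend φ (fun s => some s.1) (fun _ => none) j = some l)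
      = Finset.univ.map ⟨fun a : Fin (k l) => φ ⟨l, a⟩, fun a b h => by simpa using h⟩ := by
    ext j
    simp only [Finset.mem_filter, Finset.mem_univ, true_and, Finset.mem_map]
    constructor
    · intro h
      by_cases hj : ∃ s, φ s = j
      · obtain ⟨⟨l', a⟩, rfl⟩ := hj
        rw [φ.injective.extend_apply, Option.some_inj] at h
        subst h
        exact ⟨a, rfl⟩
      · rw [Function.extend_apply' _ _ _ hj] at h
        cases h
    · rintro ⟨a, rfl⟩
      exact φ.injective.extend_apply _ _ _
  rw [this, Finset.card_map, Finset.card_univ, Fintype.card_fin]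

theorem exists_ofReal_rpow_lt {p : ℝ} (hp : 0 < p) {c : ℝ≥0∞} (hc : c ≠ 0) :
    ∃ η : ℝ, 0 < η ∧ ENNReal.ofReal η ^ p < c := by
  have h : Tendsto (fun η : ℝ => ENNReal.ofReal η ^ p) (𝓝[>] 0) (𝓝 0) := by
    have := ((ENNReal.continuous_rpow_const (y := p)).comp ENNReal.continuous_ofReal).tendsto 0
    simp only [Function.comp_apply, ENNReal.ofReal_zero, ENNReal.zero_rpow_of_pos hp] at this
    exact this.mono_left nhdsWithin_le_nhds
  obtain ⟨η, h₁, h₂⟩ := ((h.eventually (gt_mem_nhds (pos_iff_ne_zero.2 hc))).and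
    self_mem_nhdsWithin).exists
  exact ⟨η, h₂, h₁⟩

theorem natFloor_mul_measure {Y : Type*} [MeasurableSpace Y] (ν : Measure Y) [IsFiniteMeasure ν]
    (N : ℕ) (B : Set Y) :
    (⌊N * ν.real B⌋₊ : ℝ≥0∞) ≤ N * ν B ∧ N * ν B ≤ ⌊N * ν.real B⌋₊ + 1 := by
  have h0 : 0 ≤ N * ν.real B := by positivity
  have h : (N : ℝ≥0∞) * ν B = ENNReal.ofReal (N * ν.real B) := by
    rw [ENNReal.ofReal_mul (Nat.cast_nonneg N), ENNReal.ofReal_natCast, ofReal_measureReal]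
  rw [h]
  constructor
  · rw [← ENNReal.ofReal_natCast]
    exact ENNReal.ofReal_le_ofReal (Nat.floor_le h0)
  · refine ENNReal.ofReal_le_of_le_toReal ?_
    rw [← Nat.cast_succ, ENNReal.toReal_natCast, Nat.cast_succ]
    exact (Nat.lt_floor_add_one _).le

/-- Point clouds approximate Radon probability measures of bounded support. -/
theorem exists_cloud_near {p : ℝ} (hp : 1 ≤ p) (ν : PSpace p X) (e : X) {R : ℝ}
    (hR : ν.1 (Metric.closedBall e R) = 1) {δ : ℝ} (hδ : 0 < δ) :
    ∃ (N : ℕ) (hN : 0 < N) (x : Fin N → X), dist (cloud hp hN x) ν < δ := by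
  have hp0 : 0 < p := by linarith
  have := ν.2.1
  set c : ℝ≥0∞ := ENNReal.ofReal δ ^ p with hc
  set C : ℝ≥0∞ := (ENNReal.ofReal R + ENNReal.ofReal R) ^ p with hC
  have hCt : C ≠ ∞ := ENNReal.rpow_ne_top_of_nonneg hp0.le (by simp)
  have hc0 : c / 2 ≠ 0 := by
    rw [hc]
    simp [ENNReal.rpow_eq_zero_iff, hδ, hp0.not_gt]
  obtain ⟨η, hη, hηc⟩ := exists_ofReal_rpow_lt hp0 hc0
  obtain ⟨κ, hκ, hκC⟩ := ENNReal.exists_nnreal_pos_mul_lt hCt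
    (ENNReal.div_pos hc0 ENNReal.ofNat_ne_top).ne' (b := c / 2 / 2)
  have hκ0 : (κ : ℝ≥0∞) ≠ 0 := by exact_mod_cast hκ.ne'
  have hR0 : 0 ≤ R := by
    by_contra h
    rw [Metric.closedBall_eq_empty.2 (not_le.1 h), measure_empty] at hR
    exact zero_ne_one hR
  obtain ⟨n, y, r, hy, hr, hcov⟩ := exists_shells ν.1 ν.2.2.1
    Metric.isClosed_closedBall.measurableSet hR hη hκ0
  obtain ⟨N, hN⟩ := ENNReal.exists_nat_mul_gt hκ0 (ENNReal.natCast_ne_top n)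
  have hN0 : 0 < N := by
    rcases Nat.eq_zero_or_pos N with rfl | h
    · simp at hN
    · exact h
  have hNe : (N : ℝ≥0∞) ≠ 0 := by exact_mod_cast hN0.ne'
  have hNt := ENNReal.natCast_ne_top N
  set k : Fin n → ℕ := fun l => ⌊N * ν.1.real (shell y r l)⌋₊
  have hk := fun l => natFloor_mul_measure ν.1 N (shell y r l)
  have hsum : ∑ l, k l ≤ N := by
    have : ((∑ l, k l : ℕ) : ℝ≥0∞) ≤ N := by
      rw [Nat.cast_sum]
      refine (Finset.sum_le_sum fun l _ => (hk l).1).trans ?_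
      rw [← Finset.mul_sum]
      refine (mul_le_mul_right (sum_measure_shell_le y r ν.1) _).trans ?_
      rw [measure_univ, mul_one]
    exact_mod_cast this
  obtain ⟨f, hf⟩ := exists_fibers k hsum
  -- Indices left over by the rounding are placed at `e`, which is inside the ball since `0 ≤ R`.
  set x : Fin N → X := fun j => (f j).elim e y with hx
  set q : Fin N → Fin n → ℝ≥0∞ := fun j l => if f j = some l then (N : ℝ≥0∞)⁻¹ else 0 with hq
  have hq₁ : ∀ j, ∑ l, q j l ≤ (N : ℝ≥0∞)⁻¹ := by
    intro j
    rcases hfj : f j with _ | l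
    · simp [hq, hfj]
    · simp [hq, hfj]
  have hq₂ : ∀ l, ∑ j, q j l = k l * (N : ℝ≥0∞)⁻¹ := by
    intro l
    rw [hq, ← Finset.sum_filter, Finset.sum_const, hf, nsmul_eq_mul]
  have := (cloudMeasure_mem hp hN0 x).1
  obtain ⟨γ, hγ, hcost⟩ := exists_coupling_of_plan hp0.le x ν.1 y r q hq₁
    (fun l => by
      rw [hq₂, ← div_eq_mul_inv]
      exact ENNReal.div_le_of_le_mul (by rw [mul_comm]; exact (hk l).1))
    (fun _ _ => ENNReal.ofReal η ^ p)
    (fun j l hjl z hz => by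
      have hfj : f j = some l := by by_contra h; exact hjl (by simp [hq, h])
      have : x j = y l := by simp [hx, hfj]
      rw [this, edist_comm, edist_dist]
      exact ENNReal.rpow_le_rpow
        (ENNReal.ofReal_le_ofReal ((mem_shell.1 hz).1.le.trans (hr l).le)) hp0.le)
    e (ENNReal.ofReal R)
    (fun j => by
      rw [edist_dist]
      refine ENNReal.ofReal_le_ofReal ?_
      rcases hfj : f j with _ | l
      · simpa [hx, hfj] using hR0
      · simpa [hx, hfj] using hy l)
    (by
      have h := (prob_compl_eq_zero_iff Metric.isClosed_closedBall.measurableSet).2 hR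
      filter_upwards [measure_eq_zero_iff_ae_notMem.1 h] with z hz
      rw [edist_dist]
      exact ENNReal.ofReal_le_ofReal (not_not.1 hz))
  refine ⟨N, hN0, x, wDist_lt_of_coupling hp hγ (hcost.trans_lt ?_)⟩
  have hT1 : ∑ j, ∑ l, q j l ≤ 1 := by
    refine (Finset.sum_le_sum fun j _ => hq₁ j).trans ?_
    simp [ENNReal.mul_inv_cancel hNe hNt]
  have hT2 : 1 - ∑ j, ∑ l, q j l ≤ κ + κ := by
    rw [tsub_le_iff_right, Finset.sum_comm, Finset.sum_congr rfl fun l _ => hq₂ l, ← Finset.sum_mul,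
      ← div_eq_mul_inv]
    have h₁ : (1 : ℝ≥0∞) ≤ κ + ∑ l, ν.1 (shell y r l) := by
      rw [add_comm]; exact tsub_le_iff_right.1 hcov
    have h₂ : ∑ l, ν.1 (shell y r l) ≤ (∑ l, (k l : ℝ≥0∞)) / N + κ := by
      rw [← ENNReal.mul_le_mul_iff_right hNe hNt, mul_add, ENNReal.mul_div_cancel hNe hNt,
        Finset.mul_sum]
      refine (Finset.sum_le_sum fun l _ => (hk l).2).trans ?_
      rw [Finset.sum_add_distrib]
      gcongr
      simpa using hN.le
    calc (1 : ℝ≥0∞) ≤ κ + ∑ l, ν.1 (shell y r l) := h₁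
      _ ≤ κ + ((∑ l, (k l : ℝ≥0∞)) / N + κ) := by gcongr
      _ = _ := by ring
  have hct : c ≠ ∞ := ENNReal.rpow_ne_top_of_nonneg hp0.le (by simp)
  calc ∑ j, ∑ l, q j l * ENNReal.ofReal η ^ p + (1 - ∑ j, ∑ l, q j l) * C
      ≤ 1 * ENNReal.ofReal η ^ p + (κ + κ) * C := by
        simp only [← Finset.sum_mul]
        gcongr
    _ = ENNReal.ofReal η ^ p + (κ * C + κ * C) := by ring
    _ < c / 2 + (c / 2 / 2 + c / 2 / 2) :=
        ENNReal.add_lt_add hηc (ENNReal.add_lt_add hκC hκC)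
    _ = c := by rw [ENNReal.add_halves, ENNReal.add_halves]

end PartialCouplings

/-- Two costs `s ^ p` and the convexity constant combine to exactly `(2 * s) ^ p`, so both transfers
lose only a fixed factor in the distance. -/
theorem two_rpow_mul_ofReal_rpow {p : ℝ} (hp : 0 < p) {s : ℝ} :
    (2 : ℝ≥0∞) ^ (p - 1) * (ENNReal.ofReal s ^ p + ENNReal.ofReal s ^ p) =
      ENNReal.ofReal (2 * s) ^ p := by
  rw [← two_mul, ← mul_assoc, ENNReal.ofReal_mul zero_le_two, ENNReal.mul_rpow_of_nonneg _ _ hp.le]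
  congr 1
  conv_lhs => rw [← ENNReal.rpow_one (2 : ℝ≥0∞), ← ENNReal.rpow_mul, one_mul,
    ← ENNReal.rpow_add _ _ two_ne_zero ENNReal.ofNat_ne_top, sub_add_cancel]
  simp

theorem ofReal_rpow_lt {p : ℝ} (hp : 0 < p) {s t : ℝ} (hst : s < t) (ht : 0 < t) :
    ENNReal.ofReal s ^ p < ENNReal.ofReal t ^ p :=
  ENNReal.rpow_lt_rpow ((ENNReal.ofReal_lt_ofReal_iff ht).2 hst) hp

/-! ### Lifting clouds, and uniqueness of the cloud limit. -/

section Lifting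

variable {ω : Ultrafilter ℕ} {X : ℕ → Type u} [∀ i, MetricSpace (X i)] {e : ∀ i, X i}
  [∀ i, MeasurableSpace (X i)] [∀ i, BorelSpace (X i)] {p : ℝ}

/-- A point cloud close to the pushforward of a Loeb measure lifts to point clouds close to the
internal measure. -/
theorem eventually_wDist_cloud_lt (hp : 1 ≤ p) {m : ∀ i, PSpace p (X i)} {D : ℝ}
    (hD : internalMeasure (UProd.mk ω m) (ballCompl ω e D) = 0)
    (ν : PSpace p (Ultralimit ω e)) (hν : IsLoebPushforward (UProd.mk ω m) ν.1)
    {N : ℕ} (hN : 0 < N) (x : Fin N → ∀ i, X i)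
    (hx : ∀ j, Nearstandard (hyperDist (UProd.mk ω (x j)) (UProd.mk ω e))) {s : ℝ} (hs : 0 < s)
    (h : dist (cloud hp hN fun j => (pushdown ⟨UProd.mk ω (x j), hx j⟩ : Ultralimit ω e)) ν < s) :
    ∀ᶠ i in (ω : Filter ℕ), wDist p (cloudMeasure fun j => x j i) (m i).1 < 3 * s := by
  have hp0 : 0 < p := by linarith
  have := ν.2.1
  set x' : Fin N → Ultralimit ω e := fun j => pushdown ⟨UProd.mk ω (x j), hx j⟩ with hx'
  obtain ⟨γ, hγ, hγs⟩ := exists_coupling_of_wDist_lt hp (cloud hp hN x') ν h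
  obtain ⟨b, hb, hb1, hbc⟩ := exists_disintegration (p := p) x' hγ
  set R : ℝ := ∑ j, (dist (x' j) (basePoint ω e) + 1) + |D| with hRdef
  have hRj : ∀ j, dist (x' j) (basePoint ω e) + 1 ≤ R := fun j => by
    have := Finset.single_le_sum (f := fun j => dist (x' j) (basePoint ω e) + 1)
      (fun _ _ => by positivity) (Finset.mem_univ j)
    have := abs_nonneg D
    simp only [hRdef]; linarith
  have hRD : D ≤ R := by
    have : 0 ≤ ∑ j, (dist (x' j) (basePoint ω e) + 1) :=
      Finset.sum_nonneg fun _ _ => by positivity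
    have := le_abs_self D
    simp only [hRdef]; linarith
  set C : ℝ≥0∞ := (ENNReal.ofReal R + ENNReal.ofReal R) ^ p with hC
  have hCt : C ≠ ∞ := ENNReal.rpow_ne_top_of_nonneg hp0.le (by simp)
  have hgap : ENNReal.ofReal (3 * s) ^ p - ENNReal.ofReal (2 * s) ^ p ≠ 0 :=
    (tsub_pos_of_lt (ofReal_rpow_lt hp0 (by linarith) (by linarith))).ne'
  -- The main part will cost at most `(2 * s) ^ p`. The remainder has mass at most `2 * κ` and must
  -- fit into the gap below `(3 * s) ^ p`.
  obtain ⟨κ, hκ, hκC⟩ := ENNReal.exists_nnreal_pos_mul_lt hCt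
    (b := (ENNReal.ofReal (3 * s) ^ p - ENNReal.ofReal (2 * s) ^ p) / 2)
    (ENNReal.div_pos hgap ENNReal.ofNat_ne_top).ne'
  have hκ0 : (κ : ℝ≥0∞) ≠ 0 := by exact_mod_cast hκ.ne'
  have hη : 0 < s / 3 := by positivity
  obtain ⟨n, y', r, -, hr, hcov⟩ := exists_shells ν.1 ν.2.2.1 MeasurableSet.univ measure_univ hη hκ0
  choose y hy hyy using fun l => exists_pushdown_eq (y' l)
  obtain rfl : (fun l => pushdown ⟨UProd.mk ω (y l), hy l⟩) = y' := funext hyy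
  set y' : Fin n → Ultralimit ω e := fun l => pushdown ⟨UProd.mk ω (y l), hy l⟩ with hy'
  have ht : (1 : ℝ≥0∞) - κ < 1 := ENNReal.sub_lt_self ENNReal.one_ne_top one_ne_zero hκ0
  set t : ℝ≥0∞ := 1 - κ with htdef
  have hbS : ∀ l, ∑ j, b j (shell y' r l) = ν.1 (shell y' r l) := fun l => by
    rw [← Measure.finsetSum_apply, hb]
  have hNN : (N : ℝ≥0∞) * (N : ℝ≥0∞)⁻¹ = 1 :=
    ENNReal.mul_inv_cancel (by exact_mod_cast hN.ne') (ENNReal.natCast_ne_top N)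
  set q : Fin N → Fin n → ℝ≥0∞ := fun j l => t * b j (shell y' r l) with hq
  -- In `X i`, one `s / 3` is for passing to limit distances and one for the radius of the shell. A
  -- third, for the radius of the shell in the ultralimit, turns `dist (x' j) (y' l)` into `dist (x'
  -- j) z`; together they make `s`.
  set M : Fin N → Fin n → ℝ≥0∞ := fun j l => ENNReal.ofReal (dist (x' j) (y' l) + 2 * (s / 3)) ^ p
    with hM
  have hqM : ∑ j, ∑ l, q j l * M j l ≤ 2 ^ (p - 1) *
      (∫⁻ z, edist z.1 z.2 ^ p ∂γ + ENNReal.ofReal s ^ p) := by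
    have h₁ : ∀ j, ∑ l, q j l * M j l ≤ 2 ^ (p - 1) *
        (∫⁻ z, edist (x' j) z ^ p ∂(b j) + ENNReal.ofReal s ^ p * (N : ℝ≥0∞)⁻¹) := by
      intro j
      set F : Ultralimit ω e → ℝ≥0∞ := fun z =>
        2 ^ (p - 1) * (edist (x' j) z ^ p + ENNReal.ofReal s ^ p) with hF
      have h₂ : ∀ l, q j l * M j l ≤ ∫⁻ z in shell y' r l, F z ∂(b j) := by
        intro l
        calc q j l * M j l ≤ 1 * b j (shell y' r l) * M j l := by simp only [hq]; gcongr
          _ = ∫⁻ _ in shell y' r l, M j l ∂(b j) := by rw [setLIntegral_const, one_mul, mul_comm]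
          _ ≤ _ := by
            refine setLIntegral_mono' (measurableSet_shell y' r l) fun z hz => ?_
            have hz' : dist z (y' l) < s / 3 := (mem_shell.1 hz).1.trans (hr l)
            calc M j l ≤ (edist (x' j) z + ENNReal.ofReal s) ^ p := by
                  refine ENNReal.rpow_le_rpow ?_ hp0.le
                  rw [edist_dist, ← ENNReal.ofReal_add dist_nonneg hs.le]
                  refine ENNReal.ofReal_le_ofReal ?_
                  have := dist_triangle (x' j) z (y' l)
                  linarith
              _ ≤ _ := ENNReal.rpow_add_le_mul_rpow_add_rpow _ _ hp
      refine (Finset.sum_le_sum fun l _ => h₂ l).trans ?_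
      rw [← lintegral_finsetSum_measure]
      refine (lintegral_mono' (sum_restrict_shell_le y' r (b j)) le_rfl).trans ?_
      rw [hF, lintegral_const_mul' _ _ (ENNReal.rpow_ne_top_of_nonneg (by linarith) (by simp)),
        lintegral_add_right _ measurable_const, lintegral_const, hb1]
    refine (Finset.sum_le_sum fun j _ => h₁ j).trans ?_
    rw [← Finset.mul_sum, Finset.sum_add_distrib, hbc]
    simp [mul_left_comm, hNN]
  -- One `κ` is the mass missed by the shells, the other is lost to the factor `t = 1 - κ`.
  have hrem : 1 - ∑ j, ∑ l, q j l ≤ κ + κ := by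
    rw [tsub_le_iff_right, Finset.sum_comm]
    simp only [hq, ← Finset.mul_sum, hbS]
    have hle : (1 : ℝ≥0∞) ≤ ∑ l, ν.1 (shell y' r l) + κ := tsub_le_iff_right.1 hcov
    have hle' : (1 : ℝ≥0∞) ≤ t + κ := tsub_le_iff_right.1 le_rfl
    have hle1 := (sum_measure_shell_le y' r ν.1).trans_eq measure_univ
    calc (1 : ℝ≥0∞) ≤ ∑ l, ν.1 (shell y' r l) + κ := hle
      _ ≤ (t + κ) * ∑ l, ν.1 (shell y' r l) + κ := by
        gcongr; exact le_mul_of_one_le_left zero_le hle'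
      _ ≤ t * ∑ l, ν.1 (shell y' r l) + κ * 1 + κ := by rw [add_mul]; gcongr
      _ = _ := by ring
  have e1 := eventually_all.2 (eventually_mul_measure_shell_le hν y hy r ht)
  have e2 : ∀ᶠ i in (ω : Filter ℕ), ∀ j, dist (x j i) (e i) < dist (x' j) (basePoint ω e) + 1 :=
    eventually_all.2 fun j => (tendsto_dist_pushdown (hx j) (nearstandard_base ω e)).eventually
      (gt_mem_nhds (lt_add_one _))
  have e3 : ∀ᶠ i in (ω : Filter ℕ), ∀ j l, dist (x j i) (y l i) < dist (x' j) (y' l) + s / 3 :=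
    eventually_all.2 fun j => eventually_all.2 fun l =>
      (tendsto_dist_pushdown (hx j) (hy l)).eventually (gt_mem_nhds (lt_add_of_pos_right _ hη))
  filter_upwards [e1, e2, e3, eventually_ae_dist_lt hD] with i h1 h2 h3 h4
  have := (m i).2.1
  have := (cloudMeasure_mem hp hN fun j => x j i).1
  obtain ⟨γ', hγ', hcost⟩ := exists_coupling_of_plan hp0.le (fun j => x j i) (m i).1
    (fun l => y l i) r q
    (fun j => by
      rw [hq, ← Finset.mul_sum, ← hb1 j]
      exact (mul_le_mul' ht.le (sum_measure_shell_le y' r (b j))).trans_eq (one_mul _))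
    (fun l => by
      rw [hq, ← Finset.mul_sum, hbS]
      exact h1 l)
    M
    (fun j l _ z hz => by
      refine ENNReal.rpow_le_rpow ?_ hp0.le
      rw [edist_dist]
      refine ENNReal.ofReal_le_ofReal ?_
      have hz' := (mem_shell.1 hz).1.trans (hr l)
      have := dist_triangle_right (x j i) z (y l i)
      have := h3 j l
      linarith)
    (e i) (ENNReal.ofReal R)
    (fun j => by
      rw [edist_dist]
      exact ENNReal.ofReal_le_ofReal ((h2 j).le.trans (hRj j)))
    (by
      filter_upwards [h4] with z hz
      rw [edist_dist]
      exact ENNReal.ofReal_le_ofReal (hz.le.trans hRD))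
  refine wDist_lt_of_coupling hp hγ' (hcost.trans_lt ?_)
  set g := ENNReal.ofReal (3 * s) ^ p - ENNReal.ofReal (2 * s) ^ p with hg
  have h2t : ENNReal.ofReal (2 * s) ^ p ≠ ∞ :=
    ENNReal.rpow_ne_top_of_nonneg hp0.le ENNReal.ofReal_ne_top
  calc ∑ j, ∑ l, q j l * M j l + (1 - ∑ j, ∑ l, q j l) * C
      ≤ 2 ^ (p - 1) * (ENNReal.ofReal s ^ p + ENNReal.ofReal s ^ p) + (κ + κ) * C := by
        gcongr
        exact hqM.trans (by gcongr)
    _ = ENNReal.ofReal (2 * s) ^ p + (κ * C + κ * C) := by rw [two_rpow_mul_ofReal_rpow hp0, add_mul]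
    _ < ENNReal.ofReal (2 * s) ^ p + (g / 2 + g / 2) :=
        ENNReal.add_lt_add_left h2t (ENNReal.add_lt_add hκC hκC)
    _ = ENNReal.ofReal (3 * s) ^ p := by
        rw [ENNReal.add_halves, hg, add_tsub_cancel_of_le
          (ofReal_rpow_lt hp0 (by linarith) (by linarith)).le]

theorem isCloudLimit_of_isLoebPushforward (hp : 1 ≤ p) (μ : PLim ω hp e) {D : ℝ}
    (hD : internalMeasure μ.1 (ballCompl ω e D) = 0) (ν : PSpace p (Ultralimit ω e))
    (hν : IsLoebPushforward μ.1 ν.1) : IsCloudLimit hp ν μ := by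
  obtain ⟨⟨m⟩, hμ⟩ := μ
  intro ε hε
  refine ⟨ε / 3, by positivity, fun N hN x hx h => Germ.coe_lt.2 ?_⟩
  filter_upwards [eventually_wDist_cloud_lt hp (m := m) hD ν hν hN x hx (by positivity) h] with i hi
  rwa [mul_div_cancel₀ _ three_ne_zero] at hi

theorem wDist_lt_of_cloud (hp : 1 ≤ p) {Y : Type u} [MetricSpace Y] [MeasurableSpace Y]
    [BorelSpace Y] {N : ℕ} (hN : 0 < N) (x : Fin N → Y) (α β : PSpace p Y) {s : ℝ}
    (hα : wDist p (cloudMeasure x) α.1 < s) (hβ : wDist p (cloudMeasure x) β.1 < s) :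
    wDist p α.1 β.1 < 2 * s := by
  obtain ⟨γ₁, h₁, c₁⟩ := exists_coupling_of_wDist_lt hp (cloud hp hN x) α hα
  obtain ⟨γ₂, h₂, c₂⟩ := exists_coupling_of_wDist_lt hp (cloud hp hN x) β hβ
  obtain ⟨γ, hγ, c⟩ := exists_coupling_glue hp hN x h₁ h₂
  refine wDist_lt_of_coupling hp hγ (c.trans_lt ?_)
  rw [← two_rpow_mul_ofReal_rpow (by linarith)]
  exact ENNReal.mul_lt_mul_right (ENNReal.rpow_pos (by simp) (by simp)).ne'
    (ENNReal.rpow_ne_top_of_nonneg (by linarith) (by simp)) (ENNReal.add_lt_add c₁ c₂)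

/-- A cloud close enough to the common limit `ν` has lifts within `ε / 2` of both representatives,
hence they are within `ε` of each other by gluing along the lifted cloud. -/
theorem pushdown_eq_of_isCloudLimit (hp : 1 ≤ p) {ν : PSpace p (Ultralimit ω e)}
    {μ₁ μ₂ : PLim ω hp e} (h₁ : IsCloudLimit hp ν μ₁) (h₂ : IsCloudLimit hp ν μ₂)
    (hdense : ∀ δ : ℝ, 0 < δ → ∃ (N : ℕ) (hN : 0 < N) (x : Fin N → Ultralimit ω e),
      dist (cloud hp hN x) ν < δ) :
    (pushdown μ₁ : PHat ω hp e) = pushdown μ₂ := by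
  refine Quot.sound ?_
  obtain ⟨⟨m₁⟩, hμ₁⟩ := μ₁
  obtain ⟨⟨m₂⟩, hμ₂⟩ := μ₂
  refine (show Tendsto (fun i => wDist p (m₁ i).1 (m₂ i).1) (ω : Filter ℕ) (𝓝 0) from ?_)
  refine Metric.tendsto_nhds.2 fun ε hε => ?_
  obtain ⟨δ₁, hδ₁, H₁⟩ := h₁ (ε / 2) (half_pos hε)
  obtain ⟨δ₂, hδ₂, H₂⟩ := h₂ (ε / 2) (half_pos hε)
  obtain ⟨N, hN, x', hx'⟩ := hdense (min δ₁ δ₂) (lt_min hδ₁ hδ₂)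
  choose x hx hxx using fun j => exists_pushdown_eq (x' j)
  obtain rfl : (fun j => pushdown ⟨UProd.mk ω (x j), hx j⟩) = x' := funext hxx
  have k₁ : ∀ᶠ i in (ω : Filter ℕ), wDist p (cloudMeasure fun j => x j i) (m₁ i).1 < ε / 2 :=
    Germ.coe_lt.1 (H₁ N hN x hx (hx'.trans_le (min_le_left _ _)))
  have k₂ : ∀ᶠ i in (ω : Filter ℕ), wDist p (cloudMeasure fun j => x j i) (m₂ i).1 < ε / 2 :=
    Germ.coe_lt.1 (H₂ N hN x hx (hx'.trans_le (min_le_right _ _)))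
  filter_upwards [k₁, k₂] with i a₁ a₂
  have h0 : 0 ≤ wDist p (m₁ i).1 (m₂ i).1 := ENNReal.toReal_nonneg
  rw [Real.dist_eq, sub_zero, abs_of_nonneg h0]
  have := wDist_lt_of_cloud hp hN (fun j => x j i) (m₁ i) (m₂ i) a₁ a₂
  linarith

end Lifting

end WassersteinUltralimit

theorem mainTheorem5 (ω : Ultrafilter ℕ) (hω : ∀ n : ℕ, ω ≠ pure n)
    {X : ℕ → Type*} [∀ i, MetricSpace (X i)] [∀ i, MeasurableSpace (X i)] [∀ i, BorelSpace (X i)]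
    (e : ∀ i, X i) {p : ℝ} (hp : 1 ≤ p) (μ : PLim ω hp e) (D : ℝ)
    (hD : internalMeasure μ.1 (ballCompl ω e D) = 0)
    (ν : PSpace p (Ultralimit ω e)) (hν : IsLoebPushforward μ.1 ν.1) :
    IsLifting hp μ ν := by
  have hμ := isCloudLimit_of_isLoebPushforward hp μ hD ν hν
  have hex : ∃ μ' : PLim ω hp e, IsCloudLimit hp ν μ' := ⟨μ, hμ⟩
  -- Existence of some cloud limit selects the meaningful branch, but the chosen one need not be
  -- `μ`; uniqueness identifies their classes.
  rw [IsLifting, embedding, dif_pos hex]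
  refine pushdown_eq_of_isCloudLimit hp hex.choose_spec hμ fun δ hδ => ?_
  have := ν.2.1
  obtain ⟨⟨m⟩, _⟩ := μ
  exact exists_cloud_near hp ν (basePoint ω e) (measure_closedBall_eq_one (m := m) hD hν) hδ
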